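/- Let $H$ (hospitals) and $D$ (doctors, or workers) be finite sets. Each hospital $h$ has a utility function $u^h$ assigning to each $D'\subseteq D$ and $p\in\mathbb{R}^{D'}$ a value in $\mathbb{R}\cup\{-\infty\}$ such that: if $u^h(D',p)=-\infty$ for some $p$, then $u^h(D',p')=-\infty$ for all $p'\in\mathbb{R}^{D'}$; at least one $D'$ is feasible, i.e. $u^h(D',\cdot)>-\infty$; and for each feasible $D'$ the function $u^h(D',\cdot)$ is continuous and strictly decreasing in prices. For $p\in\mathbb{R}^D$ put $u^h(D',p):=u^h(D',(p_d)_{d\in D'})$ and $D^h(p):=\operatorname{argmax}_{D'\subseteq D}u^h(D',p)$. Each doctor $d$ has a utility function $u^d:(H\times\mathbb{R})\cup\{\emptyset\}\to\mathbb{R}$ that is continuous and strictly increasing in its second argument ($\emptyset$ means unemployment; so each doctor supplies at most one unit). For $p\in\mathbb{R}^H$ put $u^d(h,p):=u^d(h,p_h)$ and $u^d(\emptyset,p):=u^d(\emptyset)$. A matching $\mu$ assigns to each hospital a set $\mu(h)\subseteq D$ and to each doctor $\mu(d)\in H\cup\{\emptyset\}$ such that $d\in\mu(h)$ if and only if $\mu(d)=h$.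 A competitive equilibrium is a pair $(\mu,p)$ of a matching and $p\in\mathbb{R}^{H\times D}$ such that $\mu(h)\in D^h((p_{hd})_{d\in D})$ for each $h$, and $u^d(\mu(d),(p_{hd})_{h\in H})=\max_{x\in H\cup\{\emptyset\}}u^d(x,(p_{hd})_{h\in H})$ for each $d$. Then $p$ is called an equilibrium price vector, and $\mu$ together with the prices $p_{hd}$ of the matched pairs is called an equilibrium allocation. It is worker-optimal (hospital-optimal) if each doctor (each hospital) weakly prefers it to every equilibrium allocation. Consider the following conditions. - Weak gross substitutability (weak GS) of $u^h$: if $p\le p'$ in $\mathbb{R}^D$, $D^h(p)=\{D'\}$ and $D^h(p')=\{D''\}$, then $\{d\in D':p'_d=p_d\}\subseteq D''$. - Law of aggregate demand (LAD) of $u^h$: if $p\le p'$ in $\mathbb{R}^D$, then for each $D'\in D^h(p')$ there is $\tilde D\in D^h(p)$ with $|\tilde D|\ge|D'|$. - Bounded compensating variations (BCV): for a hospital, $\inf\{-\sum_{d\in D'}p_d: p\in\mathbb{R}^{D'},\ u^h(D',p)>u^h(\emptyset)\}>-\infty$ for each $D'\subseteq D$; for a doctor, $\inf\{t\in\mathbb{R}:u^d(h,t)>u^d(\emptyset)\}>-\infty$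 for each $h\in H$ (where $\inf\emptyset=+\infty$). For each such matching market in which the utility functions of all hospitals satisfy weak GS and LAD, the following is true. 1. If $p,p'\in\mathbb{R}^{H\times D}$ are equilibrium price vectors, then so are $\bar p,\underline p$ defined by $\bar p_{hd}=\max\{p_{hd},p'_{hd}\}$ and $\underline p_{hd}=\min\{p_{hd},p'_{hd}\}$. 2. Let $p,p'$ be equilibrium price vectors. For each matching $\mu$ such that $(\mu,p)$ is an equilibrium there is a matching $\mu'$ such that $(\mu',p')$ is an equilibrium, $\mu(d)=\emptyset\Leftrightarrow\mu'(d)=\emptyset$ for each $d\in D$, and $|\mu(h)|=|\mu'(h)|$ for each $h\in H$. 3. If all utility functions (of hospitals and of doctors) satisfy, moreover, BCV, then there exist a worker-optimal equilibrium allocation and a hospital-optimal equilibrium allocation. Moreover, for fixed $H$ and $D$: 4. Let $\mathcal{U}$ be the set of utility profiles in which all doctors' utility functions satisfy BCV and all hospitals' utility functions satisfy BCV, weak GS and LAD. Each mechanism $\mathcal{M}$ that maps each $u\in\mathcal{U}$ to a worker-optimal equilibrium allocation under $u$ is (weakly) group-strategy-proof for workers: for each non-empty set $C\subseteq D$ and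 all $u,\tilde u\in\mathcal{U}$ with $\tilde u^{i}=u^{i}$ for every $i\in (H\cup D)\setminus C$, there is a $d\in C$ with $u^d(\mathcal{M}(u))\ge u^d(\mathcal{M}(\tilde u))$. -/

import Mathlib

/-- The utility function of a hospital over groups of doctors `D'` and prices `p : D' → ℝ`.
The value `⊥` (that is, `-∞`) means that the group is infeasible to hire. -/
@[ext]
structure HospitalUtility (D : Type*) where
  /-- The utility level of hiring the group `D'` at the prices `p ∈ ℝ^{D'}`. -/
  value : (D' : Finset D) → (D' → ℝ) → WithBot ℝ
  /-- A group that is infeasible at some prices is infeasible at all prices. -/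
  infeasible : ∀ (D' : Finset D) (p : D' → ℝ), value D' p = ⊥ → ∀ p' : D' → ℝ, value D' p' = ⊥
  /-- Some group is feasible. -/
  exists_feasible : ∃ D' : Finset D, ∀ p : D' → ℝ, value D' p ≠ ⊥
  /-- On a feasible group the utility is a continuous (real-valued) function of the prices. -/
  continuous : ∀ D' : Finset D, (∀ p : D' → ℝ, value D' p ≠ ⊥) →
    Continuous fun p : D' → ℝ => (value D' p).unbotD 0
  /-- On a feasible group the utility is strictly decreasing in the prices. -/
  strictAnti : ∀ D' : Finset D, (∀ p : D' → ℝ, value D' p ≠ ⊥) → StrictAnti (value D')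

namespace HospitalUtility

variable {D : Type*}

/-- The extension `u^h(D', p) := u^h(D', (p_d)_{d ∈ D'})` to price vectors for all doctors. -/
def valueAt (u : HospitalUtility D) (D' : Finset D) (p : D → ℝ) : WithBot ℝ :=
  u.value D' fun d => p d

/-- The demand correspondence `D^h(p) = argmax_{D' ⊆ D} u^h(D', p)`. -/
def demand (u : HospitalUtility D) (p : D → ℝ) : Set (Finset D) :=
  {D' | ∀ D'' : Finset D, u.valueAt D'' p ≤ u.valueAt D' p}

/-- Weak gross substitutability (only at prices with single-valued demand). -/
def WeakGrossSubstitutes (u : HospitalUtility D) : Prop :=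
  ∀ (p p' : D → ℝ) (D' D'' : Finset D), p ≤ p' → u.demand p = {D'} → u.demand p' = {D''} →
    ∀ d ∈ D', p' d = p d → d ∈ D''

/-- The law of aggregate demand. -/
def LawOfAggregateDemand (u : HospitalUtility D) : Prop :=
  ∀ p p' : D → ℝ, p ≤ p' → ∀ D' ∈ u.demand p', ∃ E ∈ u.demand p, D'.card ≤ E.card

/-- Bounded compensating variations for a hospital, which pays the prices: for each group `D'`,
the infimum of the transfer `-∑_{d ∈ D'} p_d` over all `p` with `u^h(D', p) > u^h(∅)` is `> -∞`. -/
def BCV (u : HospitalUtility D) : Prop :=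
  ∀ D' : Finset D,
    BddBelow ((fun p : D' → ℝ => -∑ d, p d) '' {p | u.valueAt ∅ 0 < u.value D' p})

end HospitalUtility

/-- The utility function `u^d : H × ℝ ∪ {∅} → ℝ` of a doctor (who works for at most one hospital),
continuous and strictly increasing in the price received. -/
@[ext]
structure DoctorUtility (H : Type*) where
  /-- The utility of working for `h` at a price. -/
  hired : H → ℝ → ℝ
  /-- The utility of being unemployed. -/
  unemployed : ℝ
  continuous : ∀ h, Continuous (hired h)
  strictMono : ∀ h, StrictMono (hired h)

namespace DoctorUtility

variable {H : Type*}

/-- The extension of `u^d` to `(H ∪ {∅}) × ℝ^H`; `none` stands for `∅`. -/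
def valueAt (u : DoctorUtility H) : Option H → (H → ℝ) → ℝ
  | none, _ => u.unemployed
  | some h, p => u.hired h (p h)

/-- Bounded compensating variations for a doctor, who receives the price: for each `h`, the
infimum of all `t` with `u^d(h, t) > u^d(∅)` is `> -∞`. -/
def BCV (u : DoctorUtility H) : Prop :=
  ∀ h, BddBelow {t : ℝ | u.unemployed < u.hired h t}

end DoctorUtility

/-- A profile of utility functions for the hospitals `H` and the doctors `D`. -/
@[ext]
structure UtilityProfile (H D : Type*) where
  hospital : H → HospitalUtility D
  doctor : D → DoctorUtility H

/-- A many-to-one matching; `employer d = none` means that `d` is unemployed. -/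
structure Matching (H D : Type*) where
  workers : H → Finset D
  employer : D → Option H
  mem_workers_iff : ∀ h d, d ∈ workers h ↔ employer d = some h

/-- An allocation: a matching together with prices for the realized hospital-doctor pairs. -/
structure Allocation (H D : Type*) where
  matching : Matching H D
  price : ∀ (h : H) (d : D), matching.employer d = some h → ℝ

namespace Allocation

variable {H D : Type*}

/-- The utility that doctor `d` with utility function `v` derives from an allocation. -/
def doctorUtility (A : Allocation H D) (d : D) (v : DoctorUtility H) : ℝ :=
  match hd : A.matching.employer d with
  | none => v.unemployed
  | some h => v.hired h (A.price h d hd)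

/-- The utility that hospital `h` with utility function `v` derives from an allocation. -/
def hospitalUtility (A : Allocation H D) (h : H) (v : HospitalUtility D) : WithBot ℝ :=
  v.value (A.matching.workers h) fun d => A.price h d ((A.matching.mem_workers_iff h d).1 d.2)

end Allocation

namespace UtilityProfile

variable {H D : Type*}

/-- `(μ, p)` is a competitive equilibrium. -/
def IsEquilibrium (u : UtilityProfile H D) (μ : Matching H D) (p : H → D → ℝ) : Prop :=
  (∀ h, μ.workers h ∈ (u.hospital h).demand (p h)) ∧
  ∀ d, ∀ o : Option H, (u.doctor d).valueAt o (fun h => p h d) ≤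
    (u.doctor d).valueAt (μ.employer d) (fun h => p h d)

/-- `p` is an equilibrium price vector. -/
def IsEquilibriumPrice (u : UtilityProfile H D) (p : H → D → ℝ) : Prop :=
  ∃ μ, u.IsEquilibrium μ p

/-- The allocation is induced by a competitive equilibrium. -/
def IsEquilibriumAllocation (u : UtilityProfile H D) (A : Allocation H D) : Prop :=
  ∃ p : H → D → ℝ, u.IsEquilibrium A.matching p ∧ ∀ h d hd, A.price h d hd = p h d

/-- An equilibrium allocation that every doctor weakly prefers to every equilibrium allocation. -/
def IsWorkerOptimal (u : UtilityProfile H D) (A : Allocation H D) : Prop :=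
  u.IsEquilibriumAllocation A ∧ ∀ B, u.IsEquilibriumAllocation B →
    ∀ d, B.doctorUtility d (u.doctor d) ≤ A.doctorUtility d (u.doctor d)

/-- An equilibrium allocation that every hospital weakly prefers to every equilibrium allocation. -/
def IsHospitalOptimal (u : UtilityProfile H D) (A : Allocation H D) : Prop :=
  u.IsEquilibriumAllocation A ∧ ∀ B, u.IsEquilibriumAllocation B →
    ∀ h, B.hospitalUtility h (u.hospital h) ≤ A.hospitalUtility h (u.hospital h)

/-- Doctors are weak gross substitutes for every hospital. -/
def WeakGrossSubstitutes (u : UtilityProfile H D) : Prop :=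
  ∀ h, (u.hospital h).WeakGrossSubstitutes

/-- The law of aggregate demand holds for every hospital. -/
def LawOfAggregateDemand (u : UtilityProfile H D) : Prop :=
  ∀ h, (u.hospital h).LawOfAggregateDemand

/-- All utility functions satisfy bounded compensating variations. -/
def BCV (u : UtilityProfile H D) : Prop :=
  (∀ h, (u.hospital h).BCV) ∧ ∀ d, (u.doctor d).BCV

/-- The domain of profiles on which side-optimal mechanisms are considered. (Doctors have unit
supply by the form of their utility functions.) -/
def domain (H D : Type*) : Set (UtilityProfile H D) :=
  {u | u.WeakGrossSubstitutes ∧ u.LawOfAggregateDemand ∧ u.BCV}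

end UtilityProfile

/-- A mechanism on a domain of utility profiles. -/
abbrev Mechanism {H D : Type*} (U : Set (UtilityProfile H D)) := U → Allocation H D

namespace Mechanism

variable {H D : Type*} {U : Set (UtilityProfile H D)}

/-- The mechanism selects a worker-optimal equilibrium allocation at every profile. -/
def IsWorkerOptimal (M : Mechanism U) : Prop :=
  ∀ u : U, u.1.IsWorkerOptimal (M u)

/-- (Weak) group-strategy-proofness for a set `C` of doctors: if the true profile is `u` and only
members of `C` report different utility functions, then not all of them gain strictly. -/
def IsGroupStrategyProofFor (M : Mechanism U) (C : Set D) : Prop :=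
  ∀ u u' : U, u'.1.hospital = u.1.hospital → (∀ d ∉ C, u'.1.doctor d = u.1.doctor d) →
    ∃ d ∈ C, (M u').doctorUtility d (u.1.doctor d) ≤ (M u).doctorUtility d (u.1.doctor d)

end Mechanism

open Filter Topology

namespace HospitalUtility

variable {D : Type*} {u : HospitalUtility D}

/-- The group `S` can be hired at all prices. -/
def Feasible (u : HospitalUtility D) (S : Finset D) : Prop := ∀ p, u.value S p ≠ ⊥

theorem feasible_of_valueAt_ne_bot {S : Finset D} {p : D → ℝ} (h : u.valueAt S p ≠ ⊥) :
    u.Feasible S := fun q hq => h (u.infeasible S q hq _)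

theorem valueAt_congr {S : Finset D} {p q : D → ℝ} (h : ∀ d ∈ S, p d = q d) :
    u.valueAt S p = u.valueAt S q := by
  unfold valueAt
  congr 1
  funext d
  exact h d d.2

theorem valueAt_anti {S : Finset D} {p q : D → ℝ} (h : ∀ d ∈ S, p d ≤ q d) :
    u.valueAt S q ≤ u.valueAt S p := by
  by_cases hS : u.valueAt S q = ⊥
  · simp [hS]
  · exact (u.strictAnti S (feasible_of_valueAt_ne_bot hS)).antitone fun d => h d d.2

theorem valueAt_lt {S : Finset D} {p q : D → ℝ} (hS : u.Feasible S) (h : ∀ d ∈ S, p d ≤ q d)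
    {d : D} (hd : d ∈ S) (hlt : p d < q d) : u.valueAt S q < u.valueAt S p := by
  refine u.strictAnti S hS (Pi.lt_def.2 ⟨fun d => h d d.2, ⟨d, hd⟩, hlt⟩)

/-- The real utility level of a feasible group. -/
def realValue (u : HospitalUtility D) (S : Finset D) (p : D → ℝ) : ℝ := (u.valueAt S p).unbotD 0

theorem coe_realValue {S : Finset D} (hS : u.Feasible S) (p : D → ℝ) :
    (u.realValue S p : WithBot ℝ) = u.valueAt S p := by
  have h := hS fun d => p d
  unfold realValue valueAt
  obtain ⟨x, hx⟩ := WithBot.ne_bot_iff_exists.1 h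
  rw [← hx, WithBot.unbotD_coe]

theorem continuous_realValue {S : Finset D} (hS : u.Feasible S) : Continuous (u.realValue S) :=
  (u.continuous S hS).comp (by fun_prop : Continuous fun (p : D → ℝ) (d : S) => p d)

theorem Feasible.of_mem_demand {S : Finset D} {p : D → ℝ} (h : S ∈ u.demand p) :
    u.Feasible S := by
  obtain ⟨T, hT⟩ := u.exists_feasible
  refine feasible_of_valueAt_ne_bot (p := p) fun hb => ?_
  have := h T
  rw [hb, le_bot_iff] at this
  exact hT _ this

theorem mem_demand_iff {S : Finset D} {p : D → ℝ} :
    S ∈ u.demand p ↔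
      u.Feasible S ∧ ∀ T, u.Feasible T → u.realValue T p ≤ u.realValue S p := by
  constructor
  · intro h
    have hS := Feasible.of_mem_demand h
    refine ⟨hS, fun T hT => ?_⟩
    have := h T
    rwa [← coe_realValue hT, ← coe_realValue hS, WithBot.coe_le_coe] at this
  · rintro ⟨hS, h⟩ T
    by_cases hb : u.valueAt T p = ⊥
    · simp [hb]
    · have hT := feasible_of_valueAt_ne_bot hb
      rw [← coe_realValue hT, ← coe_realValue hS, WithBot.coe_le_coe]
      exact h T hT

theorem isClosed_mem_demand (u : HospitalUtility D) (S : Finset D) :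
    IsClosed {p | S ∈ u.demand p} := by
  by_cases hS : u.Feasible S
  · have : {p | S ∈ u.demand p} =
        ⋂ (T) (_ : u.Feasible T), {p | u.realValue T p ≤ u.realValue S p} := by
      ext p
      simp [mem_demand_iff, hS]
    rw [this]
    exact isClosed_iInter fun T => isClosed_iInter fun hT =>
      isClosed_le (continuous_realValue hT) (continuous_realValue hS)
  · have : {p | S ∈ u.demand p} = ∅ := by
      ext p
      simp [mem_demand_iff, hS]
    rw [this]
    exact isClosed_empty

/-- Raising only prices of doctors outside a demanded group keeps the group demanded. -/
theorem mem_demand_of_raise {S : Finset D} {p q : D → ℝ} (h : S ∈ u.demand p)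
    (hpq : p ≤ q) (heq : ∀ d ∈ S, p d = q d) : S ∈ u.demand q := fun T =>
  (valueAt_anti fun d _ => hpq d).trans ((h T).trans_eq (valueAt_congr heq))

theorem dense_realValue_ne {S T : Finset D} (hS : u.Feasible S) {d : D} (hdS : d ∈ S) (hdT : d ∉ T) : Dense {p | u.realValue S p ≠ u.realValue T p} := by
  classical
  intro p
  by_cases hp : u.realValue S p = u.realValue T p
  · have hlim : Tendsto (fun t : ℝ => Function.update p d (p d + t)) (𝓝[>] 0) (𝓝 p) := by
      have : Continuous fun t : ℝ => Function.update p d (p d + t) := by fun_prop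
      have h0 := this.tendsto 0
      simp only [add_zero, Function.update_eq_self] at h0
      exact h0.mono_left nhdsWithin_le_nhds
    refine mem_closure_of_tendsto hlim ?_
    filter_upwards [self_mem_nhdsWithin] with t (ht : 0 < t)
    have h1 : u.valueAt S (Function.update p d (p d + t)) < u.valueAt S p := by
      refine valueAt_lt hS (fun e _ => ?_) hdS (by simpa using ht)
      by_cases he : e = d
      · subst he; simp [ht.le]
      · simp [he]
    have h2 : u.valueAt T (Function.update p d (p d + t)) = u.valueAt T p :=
      valueAt_congr fun e he => by
        rw [Function.update_of_ne]
        rintro rfl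
        exact hdT he
    rw [← coe_realValue hS, ← coe_realValue hS, WithBot.coe_lt_coe] at h1
    have h2' : u.realValue T (Function.update p d (p d + t)) = u.realValue T p := by
      simp [realValue, h2]
    change _ ≠ _
    rw [h2', ← hp]
    exact h1.ne
  · exact subset_closure hp

section Finite

variable [Finite D]

theorem demand_nonempty (u : HospitalUtility D) (p : D → ℝ) : (u.demand p).Nonempty :=
  Finite.exists_max fun S => u.valueAt S p

theorem eventually_demand_subset (u : HospitalUtility D) (p : D → ℝ) :
    ∀ᶠ q in 𝓝 p, u.demand q ⊆ u.demand p := by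
  have : ∀ S : Finset D, ∀ᶠ q in 𝓝 p, S ∈ u.demand q → S ∈ u.demand p := by
    intro S
    by_cases hS : S ∈ u.demand p
    · simp [hS]
    · have := (u.isClosed_mem_demand S).isOpen_compl.mem_nhds (show p ∈ _ from hS)
      filter_upwards [this] with q hq h
      exact absurd h hq
  filter_upwards [eventually_all.2 this] with q hq S hS
  exact hq S hS

/-- Prices with single-valued demand are generic. -/
theorem exists_isOpen_dense_demand_eq_singleton (u : HospitalUtility D) :
    ∃ G : Set (D → ℝ), IsOpen G ∧ Dense G ∧ ∀ p ∈ G, ∃ S, u.demand p = {S} := by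
  have hopen : ∀ x : {x : Finset D × Finset D // u.Feasible x.1 ∧ u.Feasible x.2 ∧ x.1 ≠ x.2},
      IsOpen {p | u.realValue x.1.1 p ≠ u.realValue x.1.2 p} := fun x =>
    isOpen_ne_fun (continuous_realValue x.2.1) (continuous_realValue x.2.2.1)
  refine ⟨⋂ x : {x : Finset D × Finset D // u.Feasible x.1 ∧ u.Feasible x.2 ∧ x.1 ≠ x.2},
    {p | u.realValue x.1.1 p ≠ u.realValue x.1.2 p}, isOpen_iInter_of_finite hopen, ?_, ?_⟩
  · cases nonempty_fintype D
    refine dense_iInter_of_isOpen hopen ?_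
    rintro ⟨⟨S, T⟩, hS, hT, hne⟩
    by_cases h : S ⊆ T
    · obtain ⟨d, hdT, hdS⟩ := Finset.exists_of_ssubset (h.ssubset_of_ne hne)
      simpa only [ne_comm] using dense_realValue_ne hT hdT hdS
    · obtain ⟨d, hdS, hdT⟩ := Finset.not_subset.1 h
      exact dense_realValue_ne hS hdS hdT
  · intro p hp
    obtain ⟨S, hS⟩ := u.demand_nonempty p
    refine ⟨S, Set.eq_singleton_iff_unique_mem.2 ⟨hS, fun T hT => ?_⟩⟩
    by_contra hne
    have h1 := mem_demand_iff.1 hS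
    have h2 := mem_demand_iff.1 hT
    exact Set.mem_iInter.1 hp ⟨(T, S), h2.1, h1.1, hne⟩
      (le_antisymm (h1.2 _ h2.1) (h2.2 _ h1.1))

/-- Arbitrarily close to `p` there are prices with single-valued demand. -/
theorem exists_demand_eq_singleton (u : HospitalUtility D) {p : D → ℝ} {P : (D → ℝ) → Prop}
    (hP : ∀ᶠ q in 𝓝 p, P q) : ∃ q S, P q ∧ u.demand q = {S} := by
  obtain ⟨G, -, hd, hG⟩ := u.exists_isOpen_dense_demand_eq_singleton
  obtain ⟨q, hPq, hq⟩ := mem_closure_iff_nhds.1 (hd p) _ hP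
  obtain ⟨S, hS⟩ := hG q hq
  exact ⟨q, S, hPq, hS⟩

/-- Gross substitutability for raised prices, starting from single-valued demand. -/
theorem WeakGrossSubstitutes.exists_mem_demand_of_le (hG : u.WeakGrossSubstitutes)
    {p p' : D → ℝ} (hpp : p ≤ p') {S : Finset D} (hS : u.demand p = {S}) :
    ∃ T ∈ u.demand p', ∀ d ∈ S, p' d = p d → d ∈ T := by
  have hlim : Tendsto (fun q => p + (q - p')) (𝓝 p') (𝓝 p) := by
    have : Continuous fun q : D → ℝ => p + (q - p') := by fun_prop
    simpa using this.tendsto p'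
  obtain ⟨q, T, ⟨h1, h2⟩, hT⟩ := u.exists_demand_eq_singleton
    ((u.eventually_demand_subset p').and (hlim.eventually (u.eventually_demand_subset p)))
  rw [hS] at h2
  have h3 : u.demand (p + (q - p')) = {S} :=
    (Set.Nonempty.subset_singleton_iff (u.demand_nonempty _)).1 h2
  refine ⟨T, h1 (by simp [hT]), fun d hd he => ?_⟩
  refine hG _ _ S T (fun e => ?_) h3 hT d hd ?_
  · have := hpp e
    simp only [Pi.add_apply, Pi.sub_apply]; linarith
  · simp [he]

/-- Gross substitutability and aggregate demand for lowered prices, starting from single-valued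
demand. -/
theorem WeakGrossSubstitutes.exists_mem_demand_of_ge (hG : u.WeakGrossSubstitutes)
    (hL : u.LawOfAggregateDemand)
    {p p' : D → ℝ} (hpp : p ≤ p') {S : Finset D} (hS : u.demand p' = {S}) :
    ∃ T ∈ u.demand p, (∀ d ∈ T, p' d = p d → d ∈ S) ∧ S.card ≤ T.card := by
  have hlim : Tendsto (fun q => p' + (q - p)) (𝓝 p) (𝓝 p') := by
    have : Continuous fun q : D → ℝ => p' + (q - p) := by fun_prop
    simpa using this.tendsto p
  obtain ⟨q, T, ⟨h1, h2⟩, hT⟩ := u.exists_demand_eq_singleton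
    ((u.eventually_demand_subset p).and (hlim.eventually (u.eventually_demand_subset p')))
  rw [hS] at h2
  have h3 : u.demand (p' + (q - p)) = {S} :=
    (Set.Nonempty.subset_singleton_iff (u.demand_nonempty _)).1 h2
  have hle : q ≤ p' + (q - p) := fun e => by
    have := hpp e
    simp only [Pi.add_apply, Pi.sub_apply]; linarith
  refine ⟨T, h1 (by simp [hT]), fun d hd he => ?_, ?_⟩
  · exact hG _ _ T S hle hT h3 d hd (by simp [he])
  · obtain ⟨E, hE, hc⟩ := hL q _ hle S (by simp [h3])
    rw [hT, Set.mem_singleton_iff] at hE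
    rwa [hE] at hc

end Finite

end HospitalUtility

namespace HospitalUtility

variable {D : Type*} {u : HospitalUtility D}

open Classical in
/-- The direction that makes the members of `S` cheaper and the others more expensive. -/
noncomputable def tilt (S : Finset D) (d : D) : ℝ := if d ∈ S then -1 else 1

theorem tilt_of_mem {S : Finset D} {d : D} (h : d ∈ S) : tilt S d = -1 := if_pos h

theorem tilt_of_notMem {S : Finset D} {d : D} (h : d ∉ S) : tilt S d = 1 := if_neg h

theorem tilt_le (S : Finset D) (d : D) : tilt S d ≤ 1 := by
  unfold tilt; split_ifs <;> norm_num

theorem neg_one_le_tilt (S : Finset D) (d : D) : -1 ≤ tilt S d := by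
  unfold tilt; split_ifs <;> norm_num

variable [Finite D]

/-- After a small increase of all prices outside a demanded group `S`, all small decreases of the
prices within `S` keep `S` demanded. -/
theorem LawOfAggregateDemand.exists_forall_lower (hL : u.LawOfAggregateDemand)
    {S : Finset D} {p : D → ℝ} (hS : S ∈ u.demand p) {q : D → ℝ} (heq : ∀ d ∈ S, q d = p d)
    (hlt : ∀ d ∉ S, p d < q d) :
    ∀ᶠ q' in 𝓝 q, q' ≤ q → S ∈ u.demand q' ∧ ∀ T ∈ u.demand q', T ⊆ S := by
  have hpq : p ≤ q := fun d => by
    by_cases hd : d ∈ S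
    · exact (heq d hd).ge
    · exact (hlt d hd).le
  have hSq : S ∈ u.demand q := mem_demand_of_raise hS hpq fun d hd => (heq d hd).symm
  have hsub : ∀ T ∈ u.demand q, T ⊆ S := by
    intro T hT d hd
    by_contra hdS
    have h1 : u.valueAt T q < u.valueAt T p :=
      valueAt_lt (Feasible.of_mem_demand hT) (fun e _ => hpq e) hd (hlt d hdS)
    have h2 := (hS T).trans_eq (valueAt_congr fun d hd => (heq d hd).symm)
    exact absurd (hT S) (not_le.2 (h1.trans_le h2))
  filter_upwards [u.eventually_demand_subset q] with q' hq' hle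
  refine ⟨?_, fun T hT => hsub T (hq' hT)⟩
  obtain ⟨E, hE, hc⟩ := hL q' q hle S hSq
  rwa [← Finset.eq_of_subset_of_card_le (hsub E (hq' hE)) hc]

/-- A demanded group stays demanded when its members become cheaper and the others more
expensive. -/
theorem mem_demand_of_improve (hG : u.WeakGrossSubstitutes) (hL : u.LawOfAggregateDemand)
    {S : Finset D} {p q : D → ℝ} (hS : S ∈ u.demand p) (hin : ∀ d ∈ S, q d ≤ p d)
    (hout : ∀ d ∉ S, p d ≤ q d) : S ∈ u.demand q := by
  classical
  set q₀ : D → ℝ := fun d => if d ∈ S then q d else p d with hq₀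
  suffices h : S ∈ u.demand q₀ by
    refine mem_demand_of_raise h (fun d => ?_) fun d hd => by simp [hq₀, hd]
    by_cases hd : d ∈ S
    · simp [hq₀, hd]
    · simpa [hq₀, hd] using hout d hd
  have hlim : Tendsto (fun ε : ℝ => fun d => q₀ d + if d ∈ S then 0 else ε) (𝓝[>] 0) (𝓝 q₀) := by
    have : Continuous fun ε : ℝ => fun d => q₀ d + if d ∈ S then 0 else ε := by
      refine continuous_pi fun d => ?_
      split_ifs <;> fun_prop
    have h0 := this.tendsto 0
    simp only [ite_self, add_zero] at h0
    exact h0.mono_left nhdsWithin_le_nhds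
  refine (u.isClosed_mem_demand S).mem_of_tendsto hlim ?_
  filter_upwards [self_mem_nhdsWithin] with ε (hε : 0 < ε)
  set r : D → ℝ := fun d => p d + if d ∈ S then 0 else ε with hr
  have hlow := hL.exists_forall_lower hS (q := r) (fun d hd => by simp [hr, hd])
    (fun d hd => by simp [hr, hd, hε])
  -- lowering all prices in `S` by a small `δ` makes `S` the unique demand
  have hlimT : ∀ T : Finset D, Tendsto (fun δ : ℝ => fun d => r d - if d ∈ T then δ else 0)
      (𝓝[>] 0) (𝓝 r) := by
    intro T
    have : Continuous fun δ : ℝ => fun d => r d - if d ∈ T then δ else 0 := by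
      refine continuous_pi fun d => ?_
      split_ifs <;> fun_prop
    have h0 := this.tendsto 0
    simp only [ite_self, sub_zero] at h0
    exact h0.mono_left nhdsWithin_le_nhds
  have hlimδ : Tendsto (fun δ : ℝ => fun d => (q₀ d + if d ∈ S then 0 else ε) -
      if d ∈ S then δ else 0) (𝓝[>] 0) (𝓝 fun d => q₀ d + if d ∈ S then 0 else ε) := by
    have : Continuous fun δ : ℝ => fun d =>
        (q₀ d + if d ∈ S then 0 else ε) - if d ∈ S then δ else 0 := by
      refine continuous_pi fun d => ?_
      split_ifs <;> fun_prop
    have h0 := this.tendsto 0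
    simp only [ite_self, sub_zero] at h0
    exact h0.mono_left nhdsWithin_le_nhds
  refine (u.isClosed_mem_demand S).mem_of_tendsto hlimδ ?_
  filter_upwards [eventually_all.2 fun T => (hlimT T).eventually hlow, self_mem_nhdsWithin]
    with δ hδ (hδ0 : 0 < δ)
  have hle : ∀ T : Finset D, (fun d => r d - if d ∈ T then δ else 0) ≤ r := fun T d => by
    dsimp only
    split_ifs <;> linarith
  have huniq : u.demand (fun d => r d - if d ∈ S then δ else 0) = {S} := by
    refine Set.eq_singleton_iff_unique_mem.2 ⟨(hδ S (hle S)).1, fun T hT => ?_⟩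
    refine ((hδ S (hle S)).2 T hT).antisymm fun d hd => ?_
    by_contra hdT
    have h1 := (hδ (S.erase d) (hle _)).1 T
    have h2 : u.valueAt T (fun e => r e - if e ∈ S then δ else 0) =
        u.valueAt T (fun e => r e - if e ∈ S.erase d then δ else 0) := by
      refine valueAt_congr fun e he => ?_
      have : e ≠ d := fun h => hdT (h ▸ he)
      simp [this]
    have h3 : u.valueAt S (fun e => r e - if e ∈ S.erase d then δ else 0) <
        u.valueAt S (fun e => r e - if e ∈ S then δ else 0) := by
      refine valueAt_lt (Feasible.of_mem_demand hS) (fun e he => ?_) hd ?_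
      · simp only [he, if_true]
        split_ifs <;> linarith
      · simp [hd, hδ0]
    exact absurd (hT S) (not_le.2 (h2.trans_le h1 |>.trans_lt h3))
  obtain ⟨T, hT, hsub, hcard⟩ := hG.exists_mem_demand_of_ge hL
    (p := fun d => (q₀ d + if d ∈ S then 0 else ε) - if d ∈ S then δ else 0) (fun d => by
      by_cases hd : d ∈ S
      · simpa [hq₀, hr, hd] using hin d hd
      · simp [hq₀, hr, hd]) huniq
  have hTS : T ⊆ S := fun d hd => by
    by_contra hdS
    exact hdS (hsub d hd (by simp [hq₀, hr, hdS]))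
  exact Finset.eq_of_subset_of_card_le hTS hcard ▸ hT

/-- If the prices of members of `S` fall and those of the others rise, every demanded group agrees
with `S` on the doctors whose price has changed. -/
theorem mem_iff_mem_of_improve (hG : u.WeakGrossSubstitutes) (hL : u.LawOfAggregateDemand)
    {S : Finset D} {p q : D → ℝ} (hS : S ∈ u.demand p) (hin : ∀ d ∈ S, q d ≤ p d)
    (hout : ∀ d ∉ S, p d ≤ q d) {T : Finset D} (hT : T ∈ u.demand q) {d : D} (hd : q d ≠ p d) :
    d ∈ T ↔ d ∈ S := by
  classical
  have hS' : S ∈ u.demand (Function.update q d (p d)) := by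
    refine mem_demand_of_improve hG hL hS (fun e he => ?_) fun e he => ?_
    · rcases eq_or_ne e d with rfl | hne
      · simp
      · simpa [hne] using hin e he
    · rcases eq_or_ne e d with rfl | hne
      · simp
      · simpa [hne] using hout e he
  have hcongr : ∀ R : Finset D, d ∉ R →
      u.valueAt R (Function.update q d (p d)) = u.valueAt R q := fun R hR =>
    valueAt_congr fun e he => by
      rw [Function.update_of_ne]
      rintro rfl
      exact hR he
  constructor
  · intro hdT
    by_contra hdS
    have h1 : u.valueAt T q < u.valueAt T (Function.update q d (p d)) := by
      refine valueAt_lt (Feasible.of_mem_demand hT) (fun e _ => ?_) hdT ?_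
      · rcases eq_or_ne e d with rfl | hne
        · simpa using hout e hdS
        · simp [hne]
      · simpa using lt_of_le_of_ne (hout d hdS) hd.symm
    exact absurd (hT S) (not_le.2 (h1.trans_le ((hS' T).trans_eq (hcongr S hdS))))
  · intro hdS
    by_contra hdT
    have h1 : u.valueAt S (Function.update q d (p d)) < u.valueAt S q := by
      refine valueAt_lt (Feasible.of_mem_demand hS) (fun e _ => ?_) hdS ?_
      · rcases eq_or_ne e d with rfl | hne
        · simpa using hin e hdS
        · simp [hne]
      · simpa using lt_of_le_of_ne (hin d hdS) hd
    exact absurd (hT S) (not_le.2 (((hcongr T hdT).symm.trans_le (hS' T)).trans_lt h1))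

theorem demand_add_tilt (hG : u.WeakGrossSubstitutes) (hL : u.LawOfAggregateDemand)
    {S : Finset D} {p : D → ℝ} (hS : S ∈ u.demand p) {t : ℝ} (ht : 0 < t) :
    u.demand (fun d => p d + t * tilt S d) = {S} := by
  have hin : ∀ d ∈ S, p d + t * tilt S d ≤ p d := fun d hd => by rw [tilt_of_mem hd]; linarith
  have hout : ∀ d ∉ S, p d ≤ p d + t * tilt S d := fun d hd => by
    rw [tilt_of_notMem hd]; linarith
  refine Set.eq_singleton_iff_unique_mem.2
    ⟨mem_demand_of_improve hG hL hS hin hout, fun T hT => ?_⟩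
  ext d
  refine mem_iff_mem_of_improve hG hL hS hin hout hT ?_
  unfold tilt
  split_ifs <;> simp [ht.ne']

theorem forall_demand_tilt_on (hG : u.WeakGrossSubstitutes) (hL : u.LawOfAggregateDemand)
    {S : Finset D} {p : D → ℝ} (hS : S ∈ u.demand p) (E : Set D) [DecidablePred (· ∈ E)] {r : ℝ}
    (hr : 0 < r) {T : Finset D}
    (hT : T ∈ u.demand (fun d => p d + if d ∈ E then 0 else r * tilt S d)) {d : D}
    (hd : d ∉ E) : d ∈ T ↔ d ∈ S := by
  refine mem_iff_mem_of_improve hG hL hS (fun e he => ?_) (fun e he => ?_) hT ?_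
  · rw [tilt_of_mem he]; split_ifs <;> linarith
  · rw [tilt_of_notMem he]; split_ifs <;> linarith
  · unfold tilt
    split_ifs <;> simp [hr.ne']

theorem exists_mem_demand_of_tilt {p : D → ℝ} {P : Finset D → Prop} (f : D → ℝ)
    (h : ∀ᶠ r in 𝓝[>] (0 : ℝ), ∃ T ∈ u.demand (fun d => p d + r * f d), P T) :
    ∃ T ∈ u.demand p, P T := by
  have hcl : IsClosed {q | ∃ T ∈ u.demand q, P T} := by
    have : {q | ∃ T ∈ u.demand q, P T} = ⋃ T ∈ {T | P T}, {q | T ∈ u.demand q} := by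
      ext q; simp [and_comm]
    rw [this]
    exact (Set.toFinite _).isClosed_biUnion fun T _ => u.isClosed_mem_demand T
  have hlim : Tendsto (fun r : ℝ => fun d => p d + r * f d) (𝓝[>] 0) (𝓝 p) := by
    have : Continuous fun r : ℝ => fun d => p d + r * f d := by fun_prop
    have h0 := this.tendsto 0
    simp only [zero_mul, add_zero] at h0
    exact h0.mono_left nhdsWithin_le_nhds
  exact hcl.mem_of_tendsto hlim h

theorem eventually_gap {p p' : D → ℝ} :
    ∀ᶠ r in 𝓝[>] (0 : ℝ), ∀ d, p d < p' d → p d + 2 * r ≤ p' d := by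
  refine eventually_all.2 fun d => ?_
  by_cases h : p d < p' d
  · have : ∀ᶠ r in 𝓝 (0 : ℝ), p d + 2 * r < p' d := by
      have hc : Continuous fun r : ℝ => p d + 2 * r := by fun_prop
      exact hc.tendsto 0 |>.eventually_lt_const (by simpa using h)
    filter_upwards [nhdsWithin_le_nhds this] with r hr _
    exact hr.le
  · simp [h]

theorem eventually_demand_tilt_subset (u : HospitalUtility D) (q f : D → ℝ) :
    ∀ᶠ t in 𝓝[>] (0 : ℝ), u.demand (fun d => q d + t * f d) ⊆ u.demand q := by
  have hlim : Tendsto (fun t : ℝ => fun d => q d + t * f d) (𝓝[>] 0) (𝓝 q) := by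
    have : Continuous fun r : ℝ => fun d => q d + r * f d := by fun_prop
    have h0 := this.tendsto 0
    simp only [zero_mul, add_zero] at h0
    exact h0.mono_left nhdsWithin_le_nhds
  exact hlim.eventually (u.eventually_demand_subset q)

/-- Gross substitutability for arbitrary selections from demand at raised prices. -/
theorem exists_mem_demand_upper (hG : u.WeakGrossSubstitutes) (hL : u.LawOfAggregateDemand)
    {p p' : D → ℝ} (hpp : p ≤ p') {S S' : Finset D} (hS : S ∈ u.demand p)
    (hS' : S' ∈ u.demand p') :
    ∃ T ∈ u.demand p', (∀ d, p d = p' d → d ∈ S → d ∈ T) ∧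
      (∀ d, p d < p' d → d ∈ S' → d ∈ T) ∧ T.card ≤ S.card := by
  classical
  refine exists_mem_demand_of_tilt (fun d => if d ∈ {d | p d = p' d} then 0 else tilt S' d) ?_
  filter_upwards [eventually_gap (p := p) (p' := p'), self_mem_nhdsWithin] with r hr (hr0 : 0 < r)
  set q : D → ℝ := fun d => p' d + if d ∈ {d | p d = p' d} then 0 else r * tilt S' d with hq
  simp only [mul_ite, mul_zero]
  have hsmall : ∀ᶠ t in 𝓝[>] (0 : ℝ), t < r := nhdsWithin_le_nhds (gt_mem_nhds hr0)
  obtain ⟨t, ⟨ht, htr⟩, (ht0 : 0 < t)⟩ := (((u.eventually_demand_tilt_subset q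
    (fun d => if p d = p' d then tilt S d else 0)).and hsmall).and self_mem_nhdsWithin).exists
  have hle : (fun d => p d + t * tilt S d) ≤
      fun d => q d + t * if p d = p' d then tilt S d else 0 := fun d => by
    by_cases hd : p d = p' d
    · simp [hq, hd]
    · have h1 := hr d (lt_of_le_of_ne (hpp d) hd)
      have h2 := mul_le_mul_of_nonneg_left (tilt_le S d) ht0.le
      have h3 := mul_le_mul_of_nonneg_left (neg_one_le_tilt S' d) hr0.le
      simp only [hq, Set.mem_ofPred_eq, hd, if_false]
      linarith
  have hD := demand_add_tilt hG hL hS ht0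
  obtain ⟨T, hT, hTS⟩ := hG.exists_mem_demand_of_le hle hD
  refine ⟨T, ht hT, fun d hd hdS => hTS d hdS (by simp [hq, hd]), fun d hd hdS => ?_, ?_⟩
  · exact (forall_demand_tilt_on hG hL hS' {d | p d = p' d} hr0 (ht hT) hd.ne).2 hdS
  · obtain ⟨E, hE, hc⟩ := hL _ _ hle T hT
    rw [hD, Set.mem_singleton_iff] at hE
    rwa [hE] at hc

/-- Gross substitutability for arbitrary selections from demand at lowered prices. -/
theorem exists_mem_demand_lower (hG : u.WeakGrossSubstitutes) (hL : u.LawOfAggregateDemand)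
    {p p' : D → ℝ} (hpp : p ≤ p') {S S' : Finset D} (hS : S ∈ u.demand p)
    (hS' : S' ∈ u.demand p') :
    ∃ T ∈ u.demand p, (∀ d, p d = p' d → d ∈ T → d ∈ S') ∧
      (∀ d, p d < p' d → d ∈ T → d ∈ S) ∧ S'.card ≤ T.card := by
  classical
  refine exists_mem_demand_of_tilt (fun d => if d ∈ {d | p d = p' d} then 0 else tilt S d) ?_
  filter_upwards [eventually_gap (p := p) (p' := p'), self_mem_nhdsWithin] with r hr (hr0 : 0 < r)
  set q : D → ℝ := fun d => p d + if d ∈ {d | p d = p' d} then 0 else r * tilt S d with hq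
  simp only [mul_ite, mul_zero]
  have hsmall : ∀ᶠ t in 𝓝[>] (0 : ℝ), t < r := nhdsWithin_le_nhds (gt_mem_nhds hr0)
  obtain ⟨t, ⟨ht, htr⟩, (ht0 : 0 < t)⟩ := (((u.eventually_demand_tilt_subset q
    (fun d => if p d = p' d then tilt S' d else 0)).and hsmall).and self_mem_nhdsWithin).exists
  have hle : (fun d => q d + t * if p d = p' d then tilt S' d else 0) ≤
      (fun d => p' d + t * tilt S' d) := fun d => by
    by_cases hd : p d = p' d
    · simp [hq, hd]
    · have h1 := hr d (lt_of_le_of_ne (hpp d) hd)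
      have h2 := mul_le_mul_of_nonneg_left (neg_one_le_tilt S' d) ht0.le
      have h3 := mul_le_mul_of_nonneg_left (tilt_le S d) hr0.le
      simp only [hq, Set.mem_ofPred_eq, hd, if_false]
      linarith
  have hD := demand_add_tilt hG hL hS' ht0
  obtain ⟨T, hT, hTS, hc⟩ := hG.exists_mem_demand_of_ge hL hle hD
  refine ⟨T, ht hT, fun d hd hdT => hTS d hdT (by simp [hq, hd]), fun d hd hdT => ?_, hc⟩
  exact (forall_demand_tilt_on hG hL hS {d | p d = p' d} hr0 (ht hT) hd.ne).1 hdT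

/-- Demand at the maximum of two price vectors. -/
theorem exists_mem_demand_max (hG : u.WeakGrossSubstitutes) (hL : u.LawOfAggregateDemand)
    {p p' : D → ℝ} {S S' : Finset D} (hS : S ∈ u.demand p) (hS' : S' ∈ u.demand p') :
    ∃ T ∈ u.demand (fun d => max (p d) (p' d)), (∀ d ∈ S, p' d ≤ p d → d ∈ T) ∧
      (∀ d ∈ S', p d < p' d → d ∈ T) ∧ T.card ≤ S.card := by
  obtain ⟨R, hR⟩ := u.demand_nonempty fun d => max (p d) (p' d)
  obtain ⟨R, hR, h1, -, -⟩ := exists_mem_demand_upper hG hL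
    (show p' ≤ fun d => max (p d) (p' d) from fun d => le_max_right _ _) hS' hR
  obtain ⟨T, hT, h2, h3, hc⟩ := exists_mem_demand_upper hG hL
    (show p ≤ fun d => max (p d) (p' d) from fun d => le_max_left _ _) hS hR
  refine ⟨T, hT, fun d hd hle => h2 d (max_eq_left hle).symm hd, fun d hd hlt => ?_, hc⟩
  exact h3 d (hlt.trans_le (le_max_right _ _)) (h1 d (max_eq_right hlt.le).symm hd)

/-- Demand at the minimum of two price vectors. -/
theorem exists_mem_demand_min (hG : u.WeakGrossSubstitutes) (hL : u.LawOfAggregateDemand)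
    {p p' : D → ℝ} {S S' : Finset D} (hS : S ∈ u.demand p) (hS' : S' ∈ u.demand p') :
    ∃ T ∈ u.demand (fun d => min (p d) (p' d)), (∀ d ∈ T, p d ≤ p' d → d ∈ S) ∧
      (∀ d ∈ T, p' d < p d → d ∈ S') ∧ S.card ≤ T.card := by
  obtain ⟨R, hR⟩ := u.demand_nonempty fun d => min (p d) (p' d)
  obtain ⟨R, hR, h1, -, -⟩ := exists_mem_demand_lower hG hL
    (show (fun d => min (p d) (p' d)) ≤ p' from fun d => min_le_right _ _) hR hS'
  obtain ⟨T, hT, h2, h3, hc⟩ := exists_mem_demand_lower hG hL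
    (show (fun d => min (p d) (p' d)) ≤ p from fun d => min_le_left _ _) hR hS
  refine ⟨T, hT, fun d hd hle => h2 d (min_eq_left hle) hd, fun d hd hlt => ?_, hc⟩
  exact h1 d (min_eq_right hlt.le) (h3 d ((min_le_right _ _).trans_lt hlt) hd)

end HospitalUtility

namespace DoctorUtility

variable {H : Type*} {v : DoctorUtility H}

@[simp]
theorem valueAt_none (p : H → ℝ) : v.valueAt none p = v.unemployed := rfl

@[simp]
theorem valueAt_some (h : H) (p : H → ℝ) : v.valueAt (some h) p = v.hired h (p h) := rfl

theorem hired_le_iff {h : H} {s t : ℝ} : v.hired h s ≤ v.hired h t ↔ s ≤ t :=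
  (v.strictMono h).le_iff_le

theorem hired_lt_iff {h : H} {s t : ℝ} : v.hired h s < v.hired h t ↔ s < t :=
  (v.strictMono h).lt_iff_lt

theorem valueAt_mono (o : Option H) {p q : H → ℝ} (hpq : p ≤ q) :
    v.valueAt o p ≤ v.valueAt o q := by
  cases o with
  | none => exact le_rfl
  | some h => exact hired_le_iff.2 (hpq h)

theorem continuous_valueAt (o : Option H) : Continuous (v.valueAt o) := by
  cases o with
  | none => exact continuous_const
  | some h => exact (v.continuous h).comp (continuous_apply h)

end DoctorUtility

namespace Matching

variable {H D : Type*}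

theorem ext_employer {μ ν : Matching H D} (h : μ.employer = ν.employer) : μ = ν := by
  obtain ⟨w, e, hw⟩ := μ
  obtain ⟨w', e', hw'⟩ := ν
  obtain rfl : e = e' := h
  obtain rfl : w = w' := by
    funext h
    ext d
    rw [hw, hw']
  rfl

instance [Finite H] [Finite D] : Finite (Matching H D) :=
  Finite.of_injective Matching.employer fun _ _ h => ext_employer h

open Classical in
/-- The matching with given employers. -/
noncomputable def ofEmployer [Fintype D] (e : D → Option H) : Matching H D where
  workers h := Finset.univ.filter fun d => e d = some h
  employer := e
  mem_workers_iff h d := by simp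

open Classical in
theorem card_employed [Fintype H] [Fintype D] (μ : Matching H D) :
    (Finset.univ.filter fun d => μ.employer d ≠ none).card = ∑ h, (μ.workers h).card := by
  rw [← Finset.card_biUnion]
  · congr 1
    ext d
    simp [μ.mem_workers_iff, Option.ne_none_iff_exists']
  · intro h _ h' _ hne
    refine Finset.disjoint_left.2 fun d hd hdh => hne ?_
    rw [μ.mem_workers_iff] at hd hdh
    simpa [hd] using hdh

/-- If everybody employed under `μ` is employed under `ν` and no hospital is larger under `ν`, then
the two matchings employ the same doctors and have the same sizes. -/
theorem employed_iff_and_card_eq [Finite H] [Finite D] {μ ν : Matching H D}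
    (hemp : ∀ d, ν.employer d = none → μ.employer d = none)
    (hcard : ∀ h, (ν.workers h).card ≤ (μ.workers h).card) :
    (∀ d, μ.employer d = none ↔ ν.employer d = none) ∧
      ∀ h, (μ.workers h).card = (ν.workers h).card := by
  classical
  cases nonempty_fintype H
  cases nonempty_fintype D
  have hsub : (Finset.univ.filter fun d => μ.employer d ≠ none) ⊆
      Finset.univ.filter fun d => ν.employer d ≠ none := fun d => by
    simpa using mt (hemp d)
  have hsum : ∑ h, (ν.workers h).card ≤ ∑ h, (μ.workers h).card :=
    Finset.sum_le_sum fun h _ => hcard h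
  have heq := Finset.eq_of_subset_of_card_le hsub (by rwa [card_employed, card_employed])
  refine ⟨fun d => ?_, fun h => ?_⟩
  · have := congrArg (d ∈ ·) heq
    simpa [not_iff_not] using this
  · have hs : ∑ h, (ν.workers h).card = ∑ h, (μ.workers h).card := by
      rw [← card_employed, ← card_employed, heq]
    exact ((Finset.sum_eq_sum_iff_of_le fun h _ => hcard h).1 hs h (Finset.mem_univ h)).symm

end Matching

namespace UtilityProfile

variable {H D : Type*} {u : UtilityProfile H D} {μ μ' : Matching H D} {p p' : H → D → ℝ}

theorem IsEquilibrium.hired_le (he : u.IsEquilibrium μ p) (h : H) (d : D) :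
    (u.doctor d).hired h (p h d) ≤ (u.doctor d).valueAt (μ.employer d) fun h => p h d :=
  he.2 d (some h)

theorem IsEquilibrium.unemployed_le (he : u.IsEquilibrium μ p) (d : D) :
    (u.doctor d).unemployed ≤ (u.doctor d).valueAt (μ.employer d) fun h => p h d :=
  he.2 d none

variable [Finite H] [Finite D]

/-- From two equilibria one obtains an equilibrium at the maximum of the prices that employs the
same doctors and has the same sizes as the first one. -/
theorem IsEquilibrium.exists_max (hG : u.WeakGrossSubstitutes) (hL : u.LawOfAggregateDemand)
    (he : u.IsEquilibrium μ p) (he' : u.IsEquilibrium μ' p') :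
    ∃ ν, u.IsEquilibrium ν (fun h d => max (p h d) (p' h d)) ∧
      (∀ d, μ.employer d = none ↔ ν.employer d = none) ∧
      ∀ h, (μ.workers h).card = (ν.workers h).card := by
  classical
  cases nonempty_fintype D
  choose T hT hT1 hT2 hTc using fun h =>
    HospitalUtility.exists_mem_demand_max (hG h) (hL h) (he.1 h) (he'.1 h)
  set v : D → ℝ := fun d => (u.doctor d).valueAt (μ.employer d) fun h => p h d with hv
  set v' : D → ℝ := fun d => (u.doctor d).valueAt (μ'.employer d) fun h => p' h d with hv'
  set ν : Matching H D := .ofEmployer fun d => if v d < v' d then μ'.employer d else μ.employer d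
    with hν
  have hνe : ∀ d, ν.employer d = if v d < v' d then μ'.employer d else μ.employer d :=
    fun d => rfl
  have hsub : ∀ h, ν.workers h ⊆ T h := by
    intro h d hd
    rw [ν.mem_workers_iff, hνe] at hd
    split_ifs at hd with hlt
    · refine hT2 h d ((μ'.mem_workers_iff h d).2 hd) ?_
      have h1 := he.hired_le h d
      have h2 : v' d = (u.doctor d).hired h (p' h d) := by simp [hv', hd]
      exact DoctorUtility.hired_lt_iff.1 ((h1.trans_lt hlt).trans_eq h2)
    · refine hT1 h d ((μ.mem_workers_iff h d).2 hd) ?_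
      have h1 := he'.hired_le h d
      have h2 : v d = (u.doctor d).hired h (p h d) := by simp [hv, hd]
      exact DoctorUtility.hired_le_iff.1 ((h1.trans (not_lt.1 hlt)).trans_eq h2)
  have hemp : ∀ d, ν.employer d = none → μ.employer d = none := by
    intro d hd
    rw [hνe] at hd
    split_ifs at hd with hlt
    · have h1 := he.unemployed_le d
      have h2 : v' d = (u.doctor d).unemployed := by simp [hv', hd]
      exact absurd (hlt.trans_eq h2) (not_lt.2 h1)
    · exact hd
  have hcard : ∀ h, (ν.workers h).card ≤ (μ.workers h).card := fun h =>
    (Finset.card_le_card (hsub h)).trans (hTc h)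
  obtain ⟨h1, h2⟩ := Matching.employed_iff_and_card_eq hemp hcard
  refine ⟨ν, ⟨fun h => ?_, fun d o => ?_⟩, h1, h2⟩
  · rw [Finset.eq_of_subset_of_card_le (hsub h) ((hTc h).trans (h2 h).le)]
    exact hT h
  · have hval : max (v d) (v' d) ≤
        (u.doctor d).valueAt (ν.employer d) fun h => max (p h d) (p' h d) := by
      rw [hνe]
      split_ifs with hlt
      · rw [max_eq_right hlt.le]
        exact DoctorUtility.valueAt_mono _ fun h => le_max_right _ _
      · rw [max_eq_left (not_lt.1 hlt)]
        exact DoctorUtility.valueAt_mono _ fun h => le_max_left _ _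
    refine le_trans ?_ hval
    cases o with
    | none => exact (he.2 d none).trans (le_max_left _ _)
    | some h =>
      rcases le_total (p h d) (p' h d) with hle | hle
      · refine le_trans ?_ (le_max_right _ _)
        simpa [hle] using he'.2 d (some h)
      · refine le_trans ?_ (le_max_left _ _)
        simpa [hle] using he.2 d (some h)

/-- From two equilibria one obtains an equilibrium at the minimum of the prices that employs the
same doctors and has the same sizes as the first one. -/
theorem IsEquilibrium.exists_min (hG : u.WeakGrossSubstitutes) (hL : u.LawOfAggregateDemand)
    (he : u.IsEquilibrium μ p) (he' : u.IsEquilibrium μ' p') :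
    ∃ ν, u.IsEquilibrium ν (fun h d => min (p h d) (p' h d)) ∧
      (∀ d, μ.employer d = none ↔ ν.employer d = none) ∧
      ∀ h, (μ.workers h).card = (ν.workers h).card := by
  classical
  cases nonempty_fintype D
  choose T hT hT1 hT2 hTc using fun h =>
    HospitalUtility.exists_mem_demand_min (hG h) (hL h) (he.1 h) (he'.1 h)
  have hval : ∀ {d h}, μ.employer d = some h →
      (u.doctor d).valueAt (μ.employer d) (fun h => p h d) = (u.doctor d).hired h (p h d) :=
    fun hd => by simp [hd]
  have hval' : ∀ {d h}, μ'.employer d = some h →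
      (u.doctor d).valueAt (μ'.employer d) (fun h => p' h d) = (u.doctor d).hired h (p' h d) :=
    fun hd => by simp [hd]
  have hcases : ∀ {d h}, d ∈ T h →
      (p h d ≤ p' h d ∧ μ.employer d = some h) ∨ (p' h d < p h d ∧ μ'.employer d = some h) := by
    intro d h hd
    rcases le_or_gt (p h d) (p' h d) with hle | hlt
    · exact .inl ⟨hle, (μ.mem_workers_iff h d).1 (hT1 h d hd hle)⟩
    · exact .inr ⟨hlt, (μ'.mem_workers_iff h d).1 (hT2 h d hd hlt)⟩
  have hmixed : ∀ {d h h'}, p h d ≤ p' h d → μ.employer d = some h → p' h' d < p h' d →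
      μ'.employer d = some h' → False := by
    intro d h h' hle hd hlt hd'
    have h1 := he'.hired_le h d
    have h2 := he.hired_le h' d
    rw [hval' hd'] at h1
    rw [hval hd] at h2
    have h3 := ((u.doctor d).strictMono h).monotone hle
    have h4 := (u.doctor d).strictMono h' hlt
    linarith
  have huniq : ∀ {d h h'}, d ∈ T h → d ∈ T h' → h = h' := by
    intro d h h' hd hd'
    rcases hcases hd with ⟨a, b⟩ | ⟨a, b⟩ <;> rcases hcases hd' with ⟨a', b'⟩ | ⟨a', b'⟩
    · exact Option.some_injective _ (b.symm.trans b')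
    · exact (hmixed a b a' b').elim
    · exact (hmixed a' b' a b).elim
    · exact Option.some_injective _ (b.symm.trans b')
  let ν : Matching H D :=
    { workers := T
      employer := fun d => if hd : ∃ h, d ∈ T h then some hd.choose else none
      mem_workers_iff := fun h d => by
        constructor
        · intro hd
          have hex : ∃ h, d ∈ T h := ⟨h, hd⟩
          rw [dif_pos hex, huniq hex.choose_spec hd]
        · intro hd
          split_ifs at hd with hex
          exact Option.some_injective _ hd ▸ hex.choose_spec }
  have hemp : ∀ d, μ.employer d = none → ν.employer d = none := by
    intro d hd
    cases hd' : ν.employer d with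
    | none => rfl
    | some h =>
      rcases hcases ((ν.mem_workers_iff h d).2 hd') with ⟨a, b⟩ | ⟨a, b⟩
      · simp [hd] at b
      · have h1 := he.hired_le h d
        have h2 := he'.unemployed_le d
        rw [hval' b] at h2
        rw [hd] at h1
        have h3 := (u.doctor d).strictMono h a
        rw [DoctorUtility.valueAt_none] at h1
        linarith
  obtain ⟨h1, h2⟩ := Matching.employed_iff_and_card_eq hemp hTc
  refine ⟨ν, ⟨hT, fun d o => ?_⟩, fun d => (h1 d).symm, fun h => (h2 h).symm⟩
  have hle : (u.doctor d).valueAt o (fun h => min (p h d) (p' h d)) ≤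
      (u.doctor d).valueAt (μ.employer d) fun h => p h d :=
    (DoctorUtility.valueAt_mono o fun h => min_le_left _ _).trans (he.2 d o)
  have hle' : (u.doctor d).valueAt o (fun h => min (p h d) (p' h d)) ≤
      (u.doctor d).valueAt (μ'.employer d) fun h => p' h d :=
    (DoctorUtility.valueAt_mono o fun h => min_le_right _ _).trans (he'.2 d o)
  cases hd : ν.employer d with
  | none =>
    rw [(h1 d).1 hd] at hle
    exact hle
  | some h =>
    rcases hcases ((ν.mem_workers_iff h d).2 hd) with ⟨a, b⟩ | ⟨a, b⟩
    · simpa [b, a] using hle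
    · simpa [b, a.le] using hle'

/-- The rural hospitals property. -/
theorem IsEquilibrium.exists_same_sizes (hG : u.WeakGrossSubstitutes)
    (hL : u.LawOfAggregateDemand) (he : u.IsEquilibrium μ p) (he' : u.IsEquilibriumPrice p') :
    ∃ ν, u.IsEquilibrium ν p' ∧ (∀ d, μ.employer d = none ↔ ν.employer d = none) ∧
      ∀ h, (μ.workers h).card = (ν.workers h).card := by
  obtain ⟨μ', he'⟩ := he'
  obtain ⟨ν, hν, h1, h2⟩ := he.exists_max hG hL he'
  obtain ⟨ξ, hξ, h3, h4⟩ := hν.exists_min hG hL he'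
  refine ⟨ξ, ?_, fun d => (h1 d).trans (h3 d), fun h => (h2 h).trans (h4 h)⟩
  simpa using hξ

end UtilityProfile

/-- A closed condition with compact parameter that can be met for all small `s > 0` can be met for
`s = 0`. -/
theorem IsCompact.exists_mem_zero_of_pos {X : Type*} [TopologicalSpace X] {K : Set X}
    (hK : IsCompact K) {Z : Set (ℝ × X)} (hZ : IsClosed Z)
    (h : ∀ s, 0 < s → s ≤ 1 → ∃ x ∈ K, (s, x) ∈ Z) : ∃ x ∈ K, ((0 : ℝ), x) ∈ Z := by
  have hc : IsCompact (Prod.fst '' ((Set.Icc (0 : ℝ) 1 ×ˢ K) ∩ Z)) :=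
    ((isCompact_Icc.prod hK).inter_right hZ).image continuous_fst
  have hsub : Set.Ioo (0 : ℝ) 1 ⊆ Prod.fst '' ((Set.Icc (0 : ℝ) 1 ×ˢ K) ∩ Z) := by
    intro s hs
    obtain ⟨x, hx, hz⟩ := h s hs.1 hs.2.le
    exact ⟨(s, x), ⟨⟨⟨hs.1.le, hs.2.le⟩, hx⟩, hz⟩, rfl⟩
  have h0 : (0 : ℝ) ∈ closure (Set.Ioo (0 : ℝ) 1) := by
    rw [closure_Ioo (by norm_num)]
    simp
  obtain ⟨⟨s, x⟩, ⟨⟨-, hx⟩, hz⟩, rfl⟩ := hc.isClosed.closure_subset_iff.2 hsub h0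
  exact ⟨x, hx, hz⟩

namespace HospitalUtility

variable {D : Type*} [Finite D]

/-- Finitely many translates of a suitable base price vector all have single-valued demand. -/
theorem exists_base_demand_eq_singleton (u : HospitalUtility D) {F : Set (D → ℝ)} (hF : F.Finite)
    {O : Set (D → ℝ)} (hO : IsOpen O) (hne : O.Nonempty) :
    ∃ b ∈ O, ∀ f ∈ F, ∃ S, u.demand (fun d => b d + f d) = {S} := by
  cases nonempty_fintype D
  obtain ⟨G, hGo, hGd, hG⟩ := u.exists_isOpen_dense_demand_eq_singleton
  have hdense : Dense (⋂ f ∈ F, (Homeomorph.addRight f) ⁻¹' G) :=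
    dense_biInter_of_isOpen (fun f _ => hGo.preimage (Homeomorph.addRight f).continuous)
      hF.countable fun f _ => hGd.preimage (Homeomorph.addRight f).isOpenMap
  obtain ⟨b, hb, hbO⟩ := hdense.inter_open_nonempty O hO hne
  exact ⟨b, hb, fun f hf => hG _ (Set.mem_iInter₂.1 hbO f hf)⟩

theorem BCV.exists_bound {u : HospitalUtility D} (hB : u.BCV) :
    ∃ C, 0 ≤ C ∧ ∀ (T : Finset D) (q : D → ℝ), u.valueAt ∅ 0 < u.valueAt T q →
      ∑ d ∈ T, q d ≤ C := by
  choose c hc using hB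
  obtain ⟨C, hC⟩ := (Set.finite_range fun T => -c T).bddAbove
  refine ⟨max C 0, le_max_right _ _, fun T q hq => le_trans ?_ (le_max_left _ _)⟩
  have h1 := hc T ⟨fun d => q d, hq, rfl⟩
  have h2 := hC ⟨T, rfl⟩
  have h3 : ∑ d : T, q d = ∑ d ∈ T, q d := Finset.sum_coe_sort T q
  simp only [h3] at h1
  dsimp only at h2
  linarith

theorem BCV.valueAt_empty_ne_bot {u : HospitalUtility D} (hB : u.BCV) : u.valueAt ∅ 0 ≠ ⊥ := by
  intro hbot
  obtain ⟨C, hC0, hC⟩ := hB.exists_bound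
  obtain ⟨T, hT⟩ := u.exists_feasible
  rcases T.eq_empty_or_nonempty with rfl | hne
  · exact hT _ hbot
  · have := hC T (fun _ => C + 1) (by rw [hbot]; exact bot_lt_iff_ne_bot.2 (hT _))
    rw [Finset.sum_const, nsmul_eq_mul] at this
    have hcard : (1 : ℝ) ≤ T.card := by exact_mod_cast hne.card_pos
    nlinarith

theorem BCV.exists_price_bound {u : HospitalUtility D} (hB : u.BCV) (L : ℝ) :
    ∃ U, ∀ (T : Finset D) (q : D → ℝ), (∀ d, L ≤ q d) → (∃ d ∈ T, U ≤ q d) →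
      u.valueAt T q < u.valueAt ∅ q := by
  classical
  cases nonempty_fintype D
  obtain ⟨C, hC0, hC⟩ := hB.exists_bound
  refine ⟨C + 2 + Fintype.card D * |L|, fun T q hq ⟨d, hd, hU⟩ => ?_⟩
  have h0 : u.valueAt ∅ q = u.valueAt ∅ 0 := valueAt_congr fun d hd => by simp at hd
  rw [h0]
  by_cases hT : u.valueAt T q = ⊥
  · rw [hT]
    exact bot_lt_iff_ne_bot.2 hB.valueAt_empty_ne_bot
  set r : D → ℝ := Function.update q d (q d - 1) with hr
  have hlt : u.valueAt T q < u.valueAt T r := by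
    refine valueAt_lt (feasible_of_valueAt_ne_bot hT) (fun e _ => ?_) hd (by simp [hr])
    rcases eq_or_ne e d with rfl | hne <;> simp [*]
  refine hlt.trans_le (not_lt.1 fun hgt => ?_)
  have hsum := hC T r hgt
  have hcard : (T.card : ℝ) * |L| ≤ Fintype.card D * |L| :=
    mul_le_mul_of_nonneg_right (by exact_mod_cast Finset.card_le_univ T) (abs_nonneg L)
  have hnn : 0 ≤ (Fintype.card D : ℝ) * |L| := by positivity
  have hle : r d + |L| ≤ ∑ e ∈ T, (r e + |L|) := by
    refine Finset.single_le_sum (f := fun e => r e + |L|) (fun e _ => ?_) hd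
    have := neg_abs_le L
    have := hq e
    have := abs_nonneg L
    rcases eq_or_ne e d with rfl | hne
    · simp only [hr, Function.update_self]; linarith
    · simp only [hr, Function.update_of_ne hne]; linarith
  rw [Finset.sum_add_distrib, Finset.sum_const, nsmul_eq_mul] at hle
  have hrd : r d = q d - 1 := by simp [hr]
  have := abs_nonneg L
  linarith

end HospitalUtility

namespace UtilityProfile

variable {H D : Type*} {u : UtilityProfile H D} {L U : ℝ}

/-- No doctor wants to work at the price `L`, and no hospital pays the price `U` as long as no price
is below `L - 1`. -/
structure IsBounded (u : UtilityProfile H D) (L U : ℝ) : Prop where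
  le : L ≤ U
  doctor : ∀ d h, (u.doctor d).hired h L ≤ (u.doctor d).unemployed
  hospital : ∀ h (T : Finset D) (q : D → ℝ), (∀ d, L - 1 ≤ q d) → (∃ d ∈ T, U ≤ q d) →
    (u.hospital h).valueAt T q < (u.hospital h).valueAt ∅ q

variable [Finite H] [Finite D]

theorem BCV.exists_isBounded (hB : u.BCV) : ∃ L U, u.IsBounded L U := by
  have hB2 := hB.2
  choose ℓ hℓ using fun x : D × H => hB2 x.1 x.2
  obtain ⟨L, hL⟩ := (Set.finite_range ℓ).bddBelow
  choose U hU using fun h => (hB.1 h).exists_price_bound (L - 1 - 1)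
  obtain ⟨V, hV⟩ := (Set.finite_range U).bddAbove
  refine ⟨L - 1, max (L - 1) V, le_max_left _ _, fun d h => ?_, ?_⟩
  · by_contra hlt
    have h1 := hℓ (d, h) (not_le.1 hlt)
    have h2 := hL ⟨(d, h), rfl⟩
    linarith
  · rintro h T q hq ⟨d, hd, hle⟩
    exact hU h T q hq ⟨d, hd, (hV ⟨h, rfl⟩).trans ((le_max_right _ _).trans hle)⟩

/-- Ascending prices on a generic grid of mesh `ε` lead to an approximate equilibrium. -/
theorem IsBounded.exists_approx_equilibrium (hB : u.IsBounded L U) (hG : u.WeakGrossSubstitutes)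
    {ε : ℝ} (hε : 0 < ε) (hε1 : ε ≤ 1) :
    ∃ (μ : Matching H D) (p : H → D → ℝ), (∀ h d, p h d ∈ Set.Icc (L - 1) (U + 2)) ∧
      (∀ h, μ.workers h ∈ (u.hospital h).demand (p h)) ∧
      (∀ d, (u.doctor d).unemployed ≤ (u.doctor d).valueAt (μ.employer d) fun h => p h d) ∧
      ∀ d h, (u.doctor d).hired h (p h d - ε) ≤
        (u.doctor d).valueAt (μ.employer d) fun h => p h d := by
  classical
  cases nonempty_fintype H
  cases nonempty_fintype D
  obtain ⟨N, hN1, hN2⟩ : ∃ N : ℕ, U - L + 1 ≤ ε * N ∧ ε * N ≤ U - L + 2 := by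
    have h0 : 0 ≤ (U - L + 1) / ε := div_nonneg (by linarith [hB.le]) hε.le
    have h1 := Nat.le_ceil ((U - L + 1) / ε)
    have h2 := Nat.ceil_lt_add_one h0
    have h3 : (U - L + 1) / ε * ε = U - L + 1 := div_mul_cancel₀ _ hε.ne'
    refine ⟨⌈(U - L + 1) / ε⌉₊, ?_, ?_⟩ <;> nlinarith
  -- a generic base of the grid and the unique demands on the grid
  have hbase : ∀ h, ∃ b : D → ℝ, (∀ d, b d ∈ Set.Ioo (L - 1) L) ∧ ∀ k : D → ℕ, (∀ d, k d ≤ N) →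
      ∃ S, (u.hospital h).demand (fun d => b d + ε * k d) = {S} := by
    intro h
    obtain ⟨b, hb, hS⟩ := (u.hospital h).exists_base_demand_eq_singleton
      (F := (fun (k : D → ℕ) d => ε * (k d : ℝ)) '' Set.Icc 0 fun _ => N)
      ((Set.finite_Icc _ _).image _) (O := Set.univ.pi fun _ => Set.Ioo (L - 1) L)
      (isOpen_set_pi Set.finite_univ fun _ _ => isOpen_Ioo)
      (Set.univ_pi_nonempty_iff.2 fun _ => Set.nonempty_Ioo.2 (by linarith))
    exact ⟨b, fun d => hb d trivial, fun k hk => hS _ ⟨k, ⟨fun d => Nat.zero_le _, hk⟩, rfl⟩⟩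
  choose b hb hsing using hbase
  set P : (H → D → ℕ) → H → D → ℝ := fun k h d => b h d + ε * k h d with hP
  choose S hS using fun (h : H) (q : D → ℝ) => (u.hospital h).demand_nonempty q
  have huniq : ∀ k : H → D → ℕ, (∀ h d, k h d ≤ N) → ∀ h,
      (u.hospital h).demand (P k h) = {S h (P k h)} := by
    intro k hk h
    obtain ⟨T, hT⟩ := hsing h (k h) (hk h)
    have h1 := hS h (P k h)
    have h2 : (u.hospital h).demand (P k h) = {T} := hT
    rw [h2, Set.mem_singleton_iff] at h1
    rw [h2, h1]
  -- options currently offered to a doctor, and the invariant of the ascending process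
  set avail : (H → D → ℕ) → D → Option H → Prop :=
    fun k d o => ∀ h, o = some h → d ∈ S h (P k h) with havail
  set Inv : (H → D → ℕ) → Prop := fun k => ∀ h d, k h d = 0 ∨ ∃ o, avail k d o ∧
    (u.doctor d).hired h (P k h d - ε) ≤ (u.doctor d).valueAt o fun h => P k h d with hInv
  have hfin : {k : H → D → ℕ | (∀ h d, k h d ≤ N) ∧ Inv k}.Finite :=
    (Set.finite_Icc 0 fun _ _ => N).subset fun k hk => ⟨fun _ _ => Nat.zero_le _, hk.1⟩
  obtain ⟨k, hk⟩ := hfin.exists_maximal ⟨0, fun _ _ => Nat.zero_le _, fun _ _ => .inl rfl⟩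
  obtain ⟨⟨hkN, hkI⟩, hmax⟩ := hk
  -- no offer is rejected
  have hbetter : ∀ h d, d ∈ S h (P k h) → ∀ o, o ≠ some h → avail k d o →
      ((u.doctor d).valueAt o fun h => P k h d) < (u.doctor d).hired h (P k h d) := by
    intro h₀ d₀ hd₀ o₁ ho₁ hav₁
    by_contra hrej
    rw [not_lt] at hrej
    set k' : H → D → ℕ := fun h d => if h = h₀ ∧ d = d₀ then k h d + 1 else k h d with hk'
    have hk'0 : k' h₀ d₀ = k h₀ d₀ + 1 := by simp [hk']
    have hk'h : ∀ h d, h ≠ h₀ → k' h d = k h d := fun h d hh => by simp [hk', hh]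
    have hk'd : ∀ h d, d ≠ d₀ → k' h d = k h d := fun h d hd => by simp [hk', hd]
    have hkk' : k ≤ k' := fun h d => by
      simp only [hk']
      split_ifs <;> omega
    have hk'N : ∀ h d, k' h d ≤ N := by
      intro h d
      simp only [hk']
      split_ifs with hc
      · obtain ⟨rfl, rfl⟩ := hc
        refine lt_of_le_of_ne (hkN h d) fun heq => ?_
        have hlt := hB.hospital h (S h (P k h)) (P k h) (fun e => ?_) ⟨d, hd₀, ?_⟩
        · exact absurd (hS h (P k h) ∅) (not_le.2 hlt)
        · have h1 := (hb h e).1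
          have h2 : 0 ≤ ε * (k h e : ℝ) := by positivity
          simp only [hP]
          linarith
        · have h1 := (hb h d).1
          simp only [hP, heq]
          linarith
      · exact hkN h d
    have hPh : ∀ h, h ≠ h₀ → P k' h = P k h := fun h hh => by
      funext d
      simp [hP, hk'h h d hh]
    have hPd : ∀ h d, d ≠ d₀ → P k' h d = P k h d := fun h d hd => by simp [hP, hk'd h d hd]
    have hPle : ∀ h, P k h ≤ P k' h := fun h d => by
      have : (k h d : ℝ) ≤ k' h d := by exact_mod_cast hkk' h d
      have := mul_le_mul_of_nonneg_left this hε.le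
      simp only [hP]
      linarith
    have hkeep : ∀ h d, ¬ (h = h₀ ∧ d = d₀) → d ∈ S h (P k h) → d ∈ S h (P k' h) := by
      intro h d hne hd
      by_cases hh : h = h₀
      · exact hG h _ _ _ _ (hPle h) (huniq k hkN h) (huniq k' hk'N h) d hd
          (hPd h d fun hdd => hne ⟨hh, hdd⟩)
      · rwa [hPh h hh]
    have hav₁' : avail k' d₀ o₁ := fun h ho => by
      refine hkeep h d₀ (fun hc => ho₁ ?_) (hav₁ h ho)
      rw [ho, hc.1]
    have hval₁ : ((u.doctor d₀).valueAt o₁ fun h => P k h d₀) ≤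
        (u.doctor d₀).valueAt o₁ fun h => P k' h d₀ :=
      DoctorUtility.valueAt_mono _ fun h => hPle h d₀
    have hpersist : ∀ d o, avail k d o → ∃ o', avail k' d o' ∧
        ((u.doctor d).valueAt o fun h => P k h d) ≤ (u.doctor d).valueAt o' fun h => P k' h d := by
      intro d o hav
      by_cases hc : o = some h₀ ∧ d = d₀
      · obtain ⟨rfl, rfl⟩ := hc
        exact ⟨o₁, hav₁', hrej.trans hval₁⟩
      · refine ⟨o, fun h ho => hkeep h d (fun hcc => hc ⟨?_, hcc.2⟩) (hav h ho),
          DoctorUtility.valueAt_mono _ fun h => hPle h d⟩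
        rw [ho, hcc.1]
    have hInv' : Inv k' := by
      intro h d
      by_cases hc : h = h₀ ∧ d = d₀
      · obtain ⟨rfl, rfl⟩ := hc
        refine .inr ⟨o₁, hav₁', le_trans (le_of_eq ?_) (hrej.trans hval₁)⟩
        congr 1
        simp only [hP, hk'0]
        push_cast
        ring
      · have hkeq : k' h d = k h d := by simp [hk', hc]
        have hPeq : P k' h d = P k h d := by simp [hP, hkeq]
        rw [hkeq, hPeq]
        refine (hkI h d).imp id ?_
        rintro ⟨o, hav, hle⟩
        obtain ⟨o', hav', hle'⟩ := hpersist d o hav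
        exact ⟨o', hav', hle.trans hle'⟩
    have hle : k' h₀ d₀ ≤ k h₀ d₀ := hmax (show k' ∈ {k : H → D → ℕ | (∀ h d, k h d ≤ N) ∧ Inv k} from ⟨hk'N, hInv'⟩)
      hkk' h₀ d₀
    rw [hk'0] at hle
    omega
  have hone : ∀ {h h' d}, d ∈ S h (P k h) → d ∈ S h' (P k h') → h = h' := by
    intro h h' d hd hd'
    by_contra hne
    have h1 := hbetter h d hd (some h') (fun hc => hne (Option.some_injective _ hc).symm)
      fun g hg => Option.some_injective _ hg ▸ hd'
    have h2 := hbetter h' d hd' (some h) (fun hc => hne (Option.some_injective _ hc))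
      fun g hg => Option.some_injective _ hg ▸ hd
    exact lt_asymm h1 h2
  let μ : Matching H D :=
    { workers := fun h => S h (P k h)
      employer := fun d => if hd : ∃ h, d ∈ S h (P k h) then some hd.choose else none
      mem_workers_iff := fun h d => by
        constructor
        · intro hd
          have hex : ∃ h, d ∈ S h (P k h) := ⟨h, hd⟩
          rw [dif_pos hex, hone hex.choose_spec hd]
        · intro hd
          split_ifs at hd with hex
          exact Option.some_injective _ hd ▸ hex.choose_spec }
  have hbest : ∀ d o, avail k d o → ((u.doctor d).valueAt o fun h => P k h d) ≤
      (u.doctor d).valueAt (μ.employer d) fun h => P k h d := by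
    intro d o hav
    cases hd : μ.employer d with
    | none =>
      cases o with
      | none => exact le_rfl
      | some h =>
        have := (μ.mem_workers_iff h d).1 (hav h rfl)
        simp [hd] at this
    | some h =>
      by_cases ho : o = some h
      · rw [ho]
      · exact (hbetter h d ((μ.mem_workers_iff h d).2 hd) o ho hav).le
  have hnone : ∀ d, (u.doctor d).unemployed ≤
      (u.doctor d).valueAt (μ.employer d) fun h => P k h d := fun d =>
    hbest d none fun h hh => by simp at hh
  refine ⟨μ, P k, fun h d => ?_, fun h => hS h (P k h), hnone, fun d h => ?_⟩
  · have h1 := hb h d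
    have h2 : (k h d : ℝ) ≤ N := by exact_mod_cast hkN h d
    have h3 := mul_le_mul_of_nonneg_left h2 hε.le
    have h4 : 0 ≤ ε * (k h d : ℝ) := by positivity
    constructor <;> simp only [hP] <;> linarith [h1.1, h1.2]
  · rcases hkI h d with h0 | ⟨o, hav, hle⟩
    · refine le_trans ?_ ((hB.doctor d h).trans (hnone d))
      refine DoctorUtility.hired_le_iff.2 ?_
      simp only [hP, h0]
      have := (hb h d).2
      push_cast
      linarith
    · exact hle.trans (hbest d o hav)

end UtilityProfile

theorem isClosed_setOf_forall {X ι : Type*} [TopologicalSpace X] {P : ι → X → Prop}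
    (h : ∀ i, IsClosed {x | P i x}) : IsClosed {x | ∀ i, P i x} := by
  rw [Set.ofPred_forall]
  exact isClosed_iInter h

/-- A nonempty compact family of price vectors that is closed under maxima has a greatest
element. -/
theorem IsCompact.exists_isGreatest_of_sup {H D : Type*} [Finite H] [Finite D]
    {P : Set (H → D → ℝ)} (hP : IsCompact P) (hne : P.Nonempty)
    (hsup : ∀ p ∈ P, ∀ q ∈ P, p ⊔ q ∈ P) : ∃ p, IsGreatest P p := by
  cases nonempty_fintype H
  cases nonempty_fintype D
  obtain ⟨p, hp, hmax⟩ := hP.exists_isMaxOn hne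
    (f := fun p => ∑ h, ∑ d, p h d) (by fun_prop)
  refine ⟨p, hp, fun q hq h d => ?_⟩
  by_contra hlt
  have h1 : ∑ h, ∑ d, (p ⊔ q) h d ≤ ∑ h, ∑ d, p h d := hmax (hsup p hp q hq)
  refine absurd h1 (not_le.2 ?_)
  refine Finset.sum_lt_sum (fun h _ => Finset.sum_le_sum fun d _ => le_sup_left)
    ⟨h, Finset.mem_univ h, Finset.sum_lt_sum (fun d _ => le_sup_left) ⟨d, Finset.mem_univ d, ?_⟩⟩
  exact (not_le.1 hlt).trans_le le_sup_right

theorem IsCompact.exists_isLeast_of_inf {H D : Type*} [Finite H] [Finite D]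
    {P : Set (H → D → ℝ)} (hP : IsCompact P) (hne : P.Nonempty)
    (hinf : ∀ p ∈ P, ∀ q ∈ P, p ⊓ q ∈ P) : ∃ p, IsLeast P p := by
  obtain ⟨p, hp⟩ := IsCompact.exists_isGreatest_of_sup hP.neg hne.neg fun p hp q hq => by
    have := hinf _ hp _ hq
    rwa [Set.mem_neg, neg_sup]
  exact ⟨-p, hp.1, fun q hq => neg_le.1 (hp.2 (Set.neg_mem_neg.2 hq))⟩

namespace Allocation

variable {H D : Type*} {A : Allocation H D} {p : H → D → ℝ}

theorem doctorUtility_eq (hp : ∀ h d hd, A.price h d hd = p h d) (d : D) (v : DoctorUtility H) :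
    A.doctorUtility d v = v.valueAt (A.matching.employer d) fun h => p h d := by
  unfold doctorUtility
  split
  next hd => rw [hd]; rfl
  next h hd =>
    rw [hp]
    simp [hd]

theorem hospitalUtility_eq (hp : ∀ h d hd, A.price h d hd = p h d) (h : H)
    (v : HospitalUtility D) : A.hospitalUtility h v = v.valueAt (A.matching.workers h) (p h) := by
  unfold hospitalUtility HospitalUtility.valueAt
  simp only [hp]

end Allocation

namespace UtilityProfile

variable {H D : Type*} {u : UtilityProfile H D} {L U : ℝ}

theorem IsEquilibrium.isEquilibriumAllocation {μ : Matching H D} {p : H → D → ℝ}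
    (he : u.IsEquilibrium μ p) : u.IsEquilibriumAllocation ⟨μ, fun h d _ => p h d⟩ :=
  ⟨p, he, fun _ _ _ => rfl⟩

theorem isClosed_setOf_hospital_demand (u : UtilityProfile H D) (μ : Matching H D) :
    IsClosed {p : H → D → ℝ | ∀ h, μ.workers h ∈ (u.hospital h).demand (p h)} :=
  isClosed_setOf_forall fun h => ((u.hospital h).isClosed_mem_demand (μ.workers h)).preimage
    (show Continuous fun p : H → D → ℝ => p h from continuous_apply h)

theorem continuous_doctor_valueAt (u : UtilityProfile H D) (d : D) (o : Option H) :
    Continuous fun p : H → D → ℝ => (u.doctor d).valueAt o fun h => p h d :=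
  (DoctorUtility.continuous_valueAt o).comp (by fun_prop)

theorem isClosed_isEquilibrium (u : UtilityProfile H D) (μ : Matching H D) :
    IsClosed {p : H → D → ℝ | u.IsEquilibrium μ p} := by
  have hdoc : IsClosed {p : H → D → ℝ | ∀ d, ∀ o : Option H,
      (u.doctor d).valueAt o (fun h => p h d) ≤
      (u.doctor d).valueAt (μ.employer d) (fun h => p h d)} :=
    isClosed_setOf_forall fun d => isClosed_setOf_forall fun o =>
      isClosed_le (u.continuous_doctor_valueAt d o) (u.continuous_doctor_valueAt d _)
  exact (u.isClosed_setOf_hospital_demand μ).inter hdoc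

/-- Truncating the prices of an equilibrium to `[L, U]` gives an equilibrium with the same
allocation. -/
theorem IsBounded.clip (hB : u.IsBounded L U) {μ : Matching H D} {p : H → D → ℝ}
    (he : u.IsEquilibrium μ p) :
    u.IsEquilibrium μ (fun h d => min (max (p h d) L) U) ∧
      ∀ h d, μ.employer d = some h → min (max (p h d) L) U = p h d := by
  have hlow : ∀ {h d}, μ.employer d = some h → L ≤ p h d := by
    intro h d hd
    have h1 := (hB.doctor d h).trans (he.unemployed_le d)
    rw [hd] at h1
    exact DoctorUtility.hired_le_iff.1 h1
  have hdem : ∀ h, μ.workers h ∈ (u.hospital h).demand fun d => max (p h d) L := fun h =>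
    HospitalUtility.mem_demand_of_raise (he.1 h) (fun d => le_max_left _ _) fun d hd =>
      (max_eq_left (hlow ((μ.mem_workers_iff h d).1 hd))).symm
  have hge : ∀ h d, L - 1 ≤ max (p h d) L := fun h d => by
    linarith [le_max_right (p h d) L]
  have hhigh : ∀ {h d}, d ∈ μ.workers h → max (p h d) L ≤ U := by
    intro h d hd
    by_contra hlt
    exact absurd (hdem h ∅)
      (not_le.2 (hB.hospital h _ _ (hge h) ⟨d, hd, (not_le.1 hlt).le⟩))
  have hmatched : ∀ h d, μ.employer d = some h → min (max (p h d) L) U = p h d := by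
    intro h d hd
    rw [min_eq_left (hhigh ((μ.mem_workers_iff h d).2 hd)), max_eq_left (hlow hd)]
  refine ⟨⟨fun h T => ?_, fun d o => ?_⟩, hmatched⟩
  · have hS : (u.hospital h).valueAt (μ.workers h) (fun d => min (max (p h d) L) U) =
        (u.hospital h).valueAt (μ.workers h) fun d => max (p h d) L :=
      HospitalUtility.valueAt_congr fun d hd => min_eq_left (hhigh hd)
    rw [hS]
    by_cases hT : ∃ d ∈ T, U ≤ max (p h d) L
    · obtain ⟨d, hd, hUd⟩ := hT
      refine (hB.hospital h T _ (fun e => ?_) ⟨d, hd, (le_min hUd le_rfl)⟩).le.trans ?_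
      · have := hB.le
        exact le_min (hge h e) (by linarith)
      · exact (HospitalUtility.valueAt_congr (by simp)).trans_le (hdem h ∅)
    · push Not at hT
      rw [HospitalUtility.valueAt_congr (q := fun d => max (p h d) L) fun d hd =>
        min_eq_left (hT d hd).le]
      exact hdem h T
  · have hval : (u.doctor d).valueAt (μ.employer d) (fun h => min (max (p h d) L) U) =
        (u.doctor d).valueAt (μ.employer d) fun h => p h d := by
      cases hd : μ.employer d with
      | none => rfl
      | some h => simp [hmatched h d hd]
    rw [hval]
    cases o with
    | none => exact he.2 d none
    | some h =>
      rcases le_total (p h d) L with hle | hle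
      · refine le_trans ?_ ((hB.doctor d h).trans (he.unemployed_le d))
        exact DoctorUtility.hired_le_iff.2 ((min_le_left _ _).trans (max_eq_right hle).le)
      · refine le_trans ?_ (he.hired_le h d)
        exact DoctorUtility.hired_le_iff.2 ((min_le_left _ _).trans (max_eq_left hle).le)

/-- The equilibrium prices in the box `[L, U]`. -/
def boxPrices (u : UtilityProfile H D) (L U : ℝ) : Set (H → D → ℝ) :=
  Set.Icc (fun _ _ => L) (fun _ _ => U) ∩ {p | u.IsEquilibriumPrice p}

theorem IsBounded.clip_mem_boxPrices (hB : u.IsBounded L U) {μ : Matching H D} {p : H → D → ℝ}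
    (he : u.IsEquilibrium μ p) : (fun h d => min (max (p h d) L) U) ∈ u.boxPrices L U :=
  ⟨⟨fun _ _ => le_min (le_max_right _ _) hB.le, fun _ _ => min_le_right _ _⟩, μ, (hB.clip he).1⟩

variable [Finite H] [Finite D]

theorem isClosed_isEquilibriumPrice (u : UtilityProfile H D) :
    IsClosed {p : H → D → ℝ | u.IsEquilibriumPrice p} := by
  have : {p : H → D → ℝ | u.IsEquilibriumPrice p} = ⋃ μ, {p | u.IsEquilibrium μ p} := by
    ext p
    simp [IsEquilibriumPrice]
  rw [this]
  exact isClosed_iUnion_of_finite fun μ => u.isClosed_isEquilibrium μ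

/-- Existence of a competitive equilibrium. -/
theorem IsBounded.boxPrices_nonempty (hB : u.IsBounded L U) (hG : u.WeakGrossSubstitutes) :
    (u.boxPrices L U).Nonempty := by
  set Z : Set (ℝ × (H → D → ℝ)) := ⋃ μ : Matching H D,
    {x | (∀ h, μ.workers h ∈ (u.hospital h).demand (x.2 h)) ∧
      (∀ d, (u.doctor d).unemployed ≤ (u.doctor d).valueAt (μ.employer d) fun h => x.2 h d) ∧
      ∀ d h, (u.doctor d).hired h (x.2 h d - x.1) ≤
        (u.doctor d).valueAt (μ.employer d) fun h => x.2 h d} with hZ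
  have hclosed : IsClosed Z := by
    refine isClosed_iUnion_of_finite fun μ => ?_
    have hc : ∀ d, Continuous fun x : ℝ × (H → D → ℝ) =>
        (u.doctor d).valueAt (μ.employer d) fun h => x.2 h d := fun d =>
      (u.continuous_doctor_valueAt d _).comp continuous_snd
    have h1 : IsClosed {x : ℝ × (H → D → ℝ) | ∀ d, (u.doctor d).unemployed ≤
        (u.doctor d).valueAt (μ.employer d) fun h => x.2 h d} :=
      isClosed_setOf_forall fun d => isClosed_le continuous_const (hc d)
    have h2 : IsClosed {x : ℝ × (H → D → ℝ) | ∀ d h, (u.doctor d).hired h (x.2 h d - x.1) ≤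
        (u.doctor d).valueAt (μ.employer d) fun h => x.2 h d} :=
      isClosed_setOf_forall fun d => isClosed_setOf_forall fun h =>
        isClosed_le (((u.doctor d).continuous h).comp (by fun_prop)) (hc d)
    exact ((u.isClosed_setOf_hospital_demand μ).preimage continuous_snd).inter (h1.inter h2)
  obtain ⟨p, -, hp⟩ := IsCompact.exists_mem_zero_of_pos
    (K := Set.Icc (fun (_ : H) (_ : D) => L - 1) (fun _ _ => U + 2)) isCompact_Icc hclosed
    fun ε hε hε1 => by
      obtain ⟨μ, p, hbox, h1, h2, h3⟩ := hB.exists_approx_equilibrium hG hε hε1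
      exact ⟨p, ⟨fun h d => (hbox h d).1, fun h d => (hbox h d).2⟩,
        Set.mem_iUnion.2 ⟨μ, h1, h2, h3⟩⟩
  obtain ⟨μ, h1, h2, h3⟩ := Set.mem_iUnion.1 hp
  have he : u.IsEquilibrium μ p := ⟨h1, fun d o => by
    cases o with
    | none => exact h2 d
    | some h => simpa using h3 d h⟩
  exact ⟨_, hB.clip_mem_boxPrices he⟩

theorem isCompact_boxPrices (u : UtilityProfile H D) (L U : ℝ) : IsCompact (u.boxPrices L U) :=
  isCompact_Icc.inter_right u.isClosed_isEquilibriumPrice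

theorem IsBounded.exists_isWorkerOptimal (hB : u.IsBounded L U) (hG : u.WeakGrossSubstitutes)
    (hL : u.LawOfAggregateDemand) : ∃ A, u.IsWorkerOptimal A := by
  obtain ⟨p, ⟨-, μ, he⟩, hmax⟩ := (u.isCompact_boxPrices L U).exists_isGreatest_of_sup
    (hB.boxPrices_nonempty hG) fun p hp q hq => by
      obtain ⟨hp1, μ, hμ⟩ := hp
      obtain ⟨hq1, ν, hν⟩ := hq
      obtain ⟨ξ, hξ, -⟩ := hμ.exists_max hG hL hν
      exact ⟨⟨hp1.1.trans le_sup_left, sup_le hp1.2 hq1.2⟩, ξ, hξ⟩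
  refine ⟨_, he.isEquilibriumAllocation, ?_⟩
  rintro B ⟨q, hq, hBq⟩ d
  have hclip := hB.clip hq
  have hBq' : ∀ h d hd, B.price h d hd = min (max (q h d) L) U := fun h d hd => by
    rw [hBq, hclip.2 h d hd]
  rw [Allocation.doctorUtility_eq hBq',
    Allocation.doctorUtility_eq (p := p) fun _ _ _ => rfl]
  exact (DoctorUtility.valueAt_mono _ fun h => hmax (hB.clip_mem_boxPrices hq) h d).trans
    (he.2 d _)

theorem IsBounded.exists_isHospitalOptimal (hB : u.IsBounded L U) (hG : u.WeakGrossSubstitutes)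
    (hL : u.LawOfAggregateDemand) : ∃ A, u.IsHospitalOptimal A := by
  obtain ⟨p, ⟨-, μ, he⟩, hmin⟩ := (u.isCompact_boxPrices L U).exists_isLeast_of_inf
    (hB.boxPrices_nonempty hG) fun p hp q hq => by
      obtain ⟨hp1, μ, hμ⟩ := hp
      obtain ⟨hq1, ν, hν⟩ := hq
      obtain ⟨ξ, hξ, -⟩ := hμ.exists_min hG hL hν
      exact ⟨⟨le_inf hp1.1 hq1.1, inf_le_left.trans hp1.2⟩, ξ, hξ⟩
  refine ⟨_, he.isEquilibriumAllocation, ?_⟩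
  rintro B ⟨q, hq, hBq⟩ h
  have hclip := hB.clip hq
  have hBq' : ∀ h d hd, B.price h d hd = min (max (q h d) L) U := fun h d hd => by
    rw [hBq, hclip.2 h d hd]
  rw [Allocation.hospitalUtility_eq hBq',
    Allocation.hospitalUtility_eq (p := p) fun _ _ _ => rfl]
  exact (HospitalUtility.valueAt_anti fun d _ => hmin (hB.clip_mem_boxPrices hq) h d).trans
    (he.1 h _)

end UtilityProfile

namespace DoctorUtility

variable {H : Type*}

/-- Change the utility of unemployment. -/
def withReservation (v : DoctorUtility H) (r : ℝ) : DoctorUtility H :=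
  { v with unemployed := r }

open Classical in
/-- Compress the utility levels above `w`, for all hospitals except `o`, to levels below `c`. -/
noncomputable def cap (v : DoctorUtility H) (o : Option H) (w c : ℝ) (hc : w < c) :
    DoctorUtility H where
  hired h t := if o = some h then v.hired h t else
    min (v.hired h t) (w + (c - w) * (v.hired h t).sigmoid)
  unemployed := v.unemployed
  continuous h := by
    have h1 := v.continuous h
    split_ifs
    · exact h1
    · have h2 : Continuous fun t => (v.hired h t).sigmoid :=
        continuous_sigmoid.comp h1
      fun_prop
  strictMono h := by
    have h1 := v.strictMono h
    split_ifs
    · exact h1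
    · intro s t hst
      have h2 := mul_lt_mul_of_pos_left (Real.sigmoid_strictMono (h1 hst)) (sub_pos.2 hc)
      exact min_lt_min (h1 hst) (by linarith)

variable {v : DoctorUtility H} {o : Option H} {w c : ℝ} {hc : w < c}

theorem cap_hired_self {h : H} (ho : o = some h) (t : ℝ) :
    (v.cap o w c hc).hired h t = v.hired h t := if_pos ho

theorem cap_hired_lt {h : H} (ho : o ≠ some h) (t : ℝ) : (v.cap o w c hc).hired h t < c := by
  have h1 := Real.sigmoid_lt_one (v.hired h t)
  have h2 : (v.cap o w c hc).hired h t = min (v.hired h t)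
    (w + (c - w) * (v.hired h t).sigmoid) := if_neg ho
  rw [h2]
  refine (min_le_right _ _).trans_lt ?_
  nlinarith

theorem cap_hired_of_le {h : H} {t : ℝ} (ht : v.hired h t ≤ w) :
    (v.cap o w c hc).hired h t = v.hired h t := by
  by_cases ho : o = some h
  · exact if_pos ho
  · have h1 := Real.sigmoid_pos (v.hired h t)
    have h2 : (v.cap o w c hc).hired h t = min (v.hired h t)
      (w + (c - w) * (v.hired h t).sigmoid) := if_neg ho
    rw [h2, min_eq_left]
    nlinarith

end DoctorUtility

namespace UtilityProfile

variable {H D : Type*} {u : UtilityProfile H D}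

/-- Change the utilities of unemployment of all doctors. -/
def withReservation (u : UtilityProfile H D) (r : D → ℝ) : UtilityProfile H D where
  hospital := u.hospital
  doctor d := (u.doctor d).withReservation (r d)

theorem valueAt_le_withReservation {r : D → ℝ} (hr : ∀ d, (u.doctor d).unemployed ≤ r d) (d : D)
    (o : Option H) (q : H → ℝ) :
    (u.doctor d).valueAt o q ≤ ((u.withReservation r).doctor d).valueAt o q := by
  cases o with
  | none => exact hr d
  | some h => exact le_rfl

/-- An equilibrium for raised reservation utilities is an equilibrium for the original ones if the
reservation utilities of the unemployed doctors have not changed. -/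
theorem IsEquilibrium.of_withReservation {r : D → ℝ} (hr : ∀ d, (u.doctor d).unemployed ≤ r d)
    {μ : Matching H D} {p : H → D → ℝ} (he : (u.withReservation r).IsEquilibrium μ p)
    (hμ : ∀ d, μ.employer d = none → r d = (u.doctor d).unemployed) : u.IsEquilibrium μ p := by
  refine ⟨he.1, fun d o => ?_⟩
  refine (valueAt_le_withReservation hr d o _).trans ((he.2 d o).trans ?_)
  cases hd : μ.employer d with
  | none => exact (hμ d hd).le
  | some h => exact le_rfl

/-- An equilibrium stays an equilibrium when reservation utilities are raised to at most the
equilibrium utilities. -/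
theorem IsEquilibrium.withReservation {r : D → ℝ} {μ : Matching H D} {p : H → D → ℝ}
    (he : u.IsEquilibrium μ p) (hr : ∀ d, (u.doctor d).unemployed ≤ r d)
    (hμ : ∀ d, r d ≤ (u.doctor d).valueAt (μ.employer d) fun h => p h d) :
    (u.withReservation r).IsEquilibrium μ p := by
  refine ⟨he.1, fun d o => le_trans ?_ (valueAt_le_withReservation hr d _ _)⟩
  cases o with
  | none => exact hμ d
  | some h => exact he.hired_le h d

theorem IsBounded.withReservation {L U : ℝ} (hB : u.IsBounded L U) {r : D → ℝ}
    (hr : ∀ d, (u.doctor d).unemployed ≤ r d) : (u.withReservation r).IsBounded L U :=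
  ⟨hB.le, fun d h => (hB.doctor d h).trans (hr d), hB.hospital⟩

variable [Finite H] [Finite D]

theorem isClosed_withReservation_isEquilibriumPrice {r : ℝ → D → ℝ} (hr : Continuous r) :
    IsClosed {x : ℝ × (H → D → ℝ) | (u.withReservation (r x.1)).IsEquilibriumPrice x.2} := by
  have hc : ∀ d (o : Option H), Continuous fun x : ℝ × (H → D → ℝ) =>
      ((u.withReservation (r x.1)).doctor d).valueAt o fun h => x.2 h d := by
    intro d o
    cases o with
    | none => exact (continuous_apply d).comp (hr.comp continuous_fst)
    | some h => exact ((u.doctor d).continuous h).comp (by fun_prop)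
  have : {x : ℝ × (H → D → ℝ) | (u.withReservation (r x.1)).IsEquilibriumPrice x.2} =
      ⋃ μ, {x | (u.withReservation (r x.1)).IsEquilibrium μ x.2} := by
    ext x
    simp [IsEquilibriumPrice]
  rw [this]
  refine isClosed_iUnion_of_finite fun μ => ?_
  have hdoc : IsClosed {x : ℝ × (H → D → ℝ) | ∀ d, ∀ o : Option H,
      ((u.withReservation (r x.1)).doctor d).valueAt o (fun h => x.2 h d) ≤
      ((u.withReservation (r x.1)).doctor d).valueAt (μ.employer d) (fun h => x.2 h d)} :=
    isClosed_setOf_forall fun d => isClosed_setOf_forall fun o => isClosed_le (hc d o) (hc d _)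
  exact ((u.isClosed_setOf_hospital_demand μ).preimage continuous_snd).inter hdoc

/-- Suppose that the doctors in `C` get more from an equilibrium `(μ', p')` at a manipulated profile
than at the prices `q`, which are in equilibrium at the true profile `u`. Then all of `C` can be
employed at the prices `q`. -/
theorem exists_isEquilibrium_employed (hG : u.WeakGrossSubstitutes) (hL : u.LawOfAggregateDemand)
    {u' : UtilityProfile H D} {C : Set D} (hH : u'.hospital = u.hospital)
    (hD : ∀ d ∉ C, u'.doctor d = u.doctor d) {μ μ' : Matching H D} {q p' : H → D → ℝ}
    (he : u.IsEquilibrium μ q) (he' : u'.IsEquilibrium μ' p')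
    (hlt : ∀ d ∈ C, ((u.doctor d).valueAt (μ.employer d) fun h => q h d) <
      (u.doctor d).valueAt (μ'.employer d) fun h => p' h d) :
    ∃ ν, u.IsEquilibrium ν q ∧ ∀ d ∈ C, ν.employer d ≠ none := by
  classical
  have hemp : ∀ d ∈ C, μ'.employer d ≠ none := fun d hd hnone => by
    have h1 := he.unemployed_le d
    have h2 := hlt d hd
    rw [hnone] at h2
    exact absurd h2 (not_lt.2 h1)
  let w : UtilityProfile H D :=
    { hospital := u.hospital
      doctor := fun d => if hd : d ∈ C then
        (u.doctor d).cap (μ'.employer d) _ _ (hlt d hd) else u.doctor d }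
  have hwq : ∀ d o, ((w.doctor d).valueAt o fun h => q h d) =
      (u.doctor d).valueAt o fun h => q h d := by
    intro d o
    by_cases hd : d ∈ C
    · simp only [w, dif_pos hd]
      cases o with
      | none => rfl
      | some h => exact DoctorUtility.cap_hired_of_le (he.hired_le h d)
    · simp only [w, dif_neg hd]
  have hw : w.IsEquilibrium μ q := ⟨he.1, fun d o => by
    rw [hwq, hwq]
    exact he.2 d o⟩
  have hw' : w.IsEquilibrium μ' p' := by
    refine ⟨fun h => ?_, fun d o => ?_⟩
    · have := he'.1 h
      rwa [hH] at this
    · by_cases hd : d ∈ C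
      · simp only [w, dif_pos hd]
        obtain ⟨h, hh⟩ := Option.ne_none_iff_exists'.1 (hemp d hd)
        have hval : (((u.doctor d).cap (μ'.employer d) _ _ (hlt d hd)).valueAt (μ'.employer d)
            fun h => p' h d) = (u.doctor d).valueAt (μ'.employer d) fun h => p' h d := by
          conv_lhs => arg 2; rw [hh]
          conv_rhs => rw [hh]
          exact DoctorUtility.cap_hired_self hh _
        rw [hval]
        cases o with
        | none => exact (he.unemployed_le d).trans (hlt d hd).le
        | some g =>
          by_cases hg : μ'.employer d = some g
          · rw [← hg, hval]
          · exact (DoctorUtility.cap_hired_lt hg _).le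
      · simp only [w, dif_neg hd]
        rw [← hD d hd]
        exact he'.2 d o
  obtain ⟨ν, hν, h1, -⟩ := IsEquilibrium.exists_same_sizes (u := w) hG hL hw' ⟨μ, hw⟩
  refine ⟨ν, ⟨hν.1, fun d o => ?_⟩, fun d hd => mt (h1 d).2 (hemp d hd)⟩
  have := hν.2 d o
  rwa [hwq, hwq] at this

/-- No coalition of doctors can make all its members better off than in the worker-optimal
equilibrium by misreporting. -/
theorem IsWorkerOptimal.exists_doctorUtility_le {L U : ℝ} (hB : u.IsBounded L U)
    (hG : u.WeakGrossSubstitutes) (hL : u.LawOfAggregateDemand) {A B : Allocation H D}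
    (hA : u.IsWorkerOptimal A) {u' : UtilityProfile H D} {C : Set D} (hC : C.Nonempty)
    (hH : u'.hospital = u.hospital) (hD : ∀ d ∉ C, u'.doctor d = u.doctor d)
    (hE : u'.IsEquilibriumAllocation B) :
    ∃ d ∈ C, B.doctorUtility d (u.doctor d) ≤ A.doctorUtility d (u.doctor d) := by
  classical
  by_contra! hlt
  obtain ⟨⟨p, he, hp⟩, hopt⟩ := hA
  obtain ⟨p', he', hp'⟩ := hE
  set v : D → ℝ := fun d => A.doctorUtility d (u.doctor d) with hv
  set v' : D → ℝ := fun d => B.doctorUtility d (u.doctor d) with hv'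
  have hvA : ∀ d, v d = (u.doctor d).valueAt (A.matching.employer d) fun h => p h d := fun d =>
    Allocation.doctorUtility_eq hp d _
  have hvB : ∀ d, v' d = (u.doctor d).valueAt (B.matching.employer d) fun h => p' h d := fun d =>
    Allocation.doctorUtility_eq hp' d _
  have hopt' : ∀ ν q, u.IsEquilibrium ν q → ∀ d,
      ((u.doctor d).valueAt (ν.employer d) fun h => q h d) ≤ v d := fun ν q hν d => by
    have := hopt _ hν.isEquilibriumAllocation d
    rwa [Allocation.doctorUtility_eq (p := q) fun _ _ _ => rfl] at this
  have hunv : ∀ d, (u.doctor d).unemployed ≤ v d := fun d => by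
    rw [hvA]
    exact he.unemployed_le d
  -- reservation utilities slightly above the worker-optimal utilities
  set r : ℝ → D → ℝ := fun s d =>
    if d ∈ C then v d + s * ((v' d - v d) / 2) else (u.doctor d).unemployed with hr
  have hrC : ∀ s, ∀ d ∈ C, r s d = v d + s * ((v' d - v d) / 2) := fun s d hd => if_pos hd
  have hrc : Continuous r := by
    refine continuous_pi fun d => ?_
    simp only [hr]
    split_ifs <;> fun_prop
  have hru : ∀ s, 0 ≤ s → ∀ d, (u.doctor d).unemployed ≤ r s d := by
    intro s hs d
    by_cases hd : d ∈ C
    · have h1 : 0 ≤ s * ((v' d - v d) / 2) := mul_nonneg hs (by linarith [hlt d hd])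
      rw [hrC s d hd]
      linarith [hunv d]
    · simp [hr, hd]
  -- at such reservation utilities some doctor in `C` is offered more than in the manipulation
  have hkey : ∀ s, 0 < s → s ≤ 1 → ∀ q, (u.withReservation (r s)).IsEquilibriumPrice q →
      ∃ d ∈ C, ∃ h, v' d ≤ (u.doctor d).hired h (q h d) := by
    rintro s hs hs1 q ⟨μ, hμ⟩
    by_contra! hsmall
    have hval : ∀ d ∈ C, (((u.withReservation (r s)).doctor d).valueAt (μ.employer d)
        fun h => q h d) < v' d := by
      intro d hd
      cases μ.employer d with
      | none =>
        change r s d < v' d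
        rw [hrC s d hd]
        nlinarith [hlt d hd]
      | some h => exact hsmall d hd h
    have hDs : ∀ d ∉ C, u'.doctor d = (u.withReservation (r s)).doctor d := fun d hd => by
      have : r s d = (u.doctor d).unemployed := if_neg hd
      simp only [withReservation, hD d hd, this]
      rfl
    obtain ⟨ν, hν, hemp⟩ := exists_isEquilibrium_employed (u := u.withReservation (r s)) hG hL hH
      hDs hμ he' fun d hd => (hval d hd).trans_le
        ((hvB d).trans_le (valueAt_le_withReservation (hru s hs.le) d _ _))
    have hνu : u.IsEquilibrium ν q := hν.of_withReservation (hru s hs.le) fun d hd =>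
      if_neg fun hdC => hemp d hdC hd
    obtain ⟨d, hd⟩ := hC
    obtain ⟨h, hh⟩ := Option.ne_none_iff_exists'.1 (hemp d hd)
    have h1 : r s d ≤ _ := hν.unemployed_le d
    have h2 := hopt' ν q hνu d
    rw [hh] at h1 h2
    rw [hrC s d hd] at h1
    have h3 : v d + s * ((v' d - v d) / 2) ≤ v d := h1.trans h2
    have h4 : 0 < s * ((v' d - v d) / 2) := mul_pos hs (by linarith [hlt d hd])
    linarith
  -- let the reservation utilities decrease to the worker-optimal utilities
  have hclosed : IsClosed ({x : ℝ × (H → D → ℝ) |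
      (u.withReservation (r x.1)).IsEquilibriumPrice x.2} ∩
      ⋃ d ∈ C, ⋃ h, {x | v' d ≤ (u.doctor d).hired h (x.2 h d)}) := by
    refine (isClosed_withReservation_isEquilibriumPrice hrc).inter
      (C.toFinite.isClosed_biUnion fun d _ => isClosed_iUnion_of_finite fun h => ?_)
    exact isClosed_le continuous_const (((u.doctor d).continuous h).comp (by fun_prop))
  obtain ⟨q, -, ⟨μ, hμ⟩, hq⟩ := IsCompact.exists_mem_zero_of_pos
    (K := Set.Icc (fun (_ : H) (_ : D) => L) (fun _ _ => U)) isCompact_Icc hclosed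
    fun s hs hs1 => by
      obtain ⟨q, hbox, hq⟩ := (hB.withReservation (hru s hs.le)).boxPrices_nonempty hG
      obtain ⟨d, hd, h, hle⟩ := hkey s hs hs1 q hq
      exact ⟨q, hbox, hq, Set.mem_iUnion₂.2 ⟨d, hd, Set.mem_iUnion.2 ⟨h, hle⟩⟩⟩
  obtain ⟨d, hd, hq⟩ := Set.mem_iUnion₂.1 hq
  obtain ⟨h, hle⟩ := Set.mem_iUnion.1 hq
  have hr0 : ∀ d ∈ C, r 0 d = v d := fun d hd => by simp [hrC 0 d hd]
  have hA0 : (u.withReservation (r 0)).IsEquilibrium A.matching p :=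
    he.withReservation (hru 0 le_rfl) fun e => by
      rw [← hvA]
      by_cases hdC : e ∈ C
      · exact (hr0 e hdC).le
      · exact (if_neg hdC).trans_le (hunv e)
  obtain ⟨ν, hν, hemp, -⟩ := IsEquilibrium.exists_same_sizes (u := u.withReservation (r 0)) hG hL
    hA0 ⟨μ, hμ⟩
  have hνu : u.IsEquilibrium ν q := hν.of_withReservation (hru 0 le_rfl) fun e hnone => by
    by_cases hdC : e ∈ C
    · rw [hr0 e hdC, hvA, (hemp e).2 hnone]
      rfl
    · exact if_neg hdC
  have h1 := hνu.hired_le h d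
  have h2 := hopt' ν q hνu d
  have h3 : v' d ≤ (u.doctor d).hired h (q h d) := hle
  exact absurd (hlt d hd) (not_lt.2 (h3.trans (h1.trans h2)))

end UtilityProfile

theorem corollary2 {H D : Type*} [Finite H] [Finite D] :
    (∀ u : UtilityProfile H D, u.WeakGrossSubstitutes → u.LawOfAggregateDemand →
      -- the lattice property
      (∀ p p' : H → D → ℝ, u.IsEquilibriumPrice p → u.IsEquilibriumPrice p' →
        u.IsEquilibriumPrice (fun h d => max (p h d) (p' h d)) ∧
        u.IsEquilibriumPrice (fun h d => min (p h d) (p' h d))) ∧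
      -- the rural hospitals property
      (∀ p p' : H → D → ℝ, u.IsEquilibriumPrice p → u.IsEquilibriumPrice p' →
        ∀ μ : Matching H D, u.IsEquilibrium μ p →
          ∃ μ' : Matching H D, u.IsEquilibrium μ' p' ∧
            (∀ d, μ.employer d = none ↔ μ'.employer d = none) ∧
            ∀ h, (μ.workers h).card = (μ'.workers h).card) ∧
      -- the existence of side-optimal equilibrium allocations
      (u.BCV → (∃ A, u.IsWorkerOptimal A) ∧ ∃ A, u.IsHospitalOptimal A)) ∧
    -- group-strategy-proofness of every worker-optimal mechanism, for every coalition of workers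
    (∀ M : Mechanism (UtilityProfile.domain H D), M.IsWorkerOptimal →
      ∀ C : Set D, C.Nonempty → M.IsGroupStrategyProofFor C) := by
  refine ⟨fun u hG hL => ⟨?_, ?_, fun hB => ?_⟩, ?_⟩
  · rintro p p' ⟨μ, he⟩ ⟨μ', he'⟩
    obtain ⟨ν, hν, -⟩ := he.exists_max hG hL he'
    obtain ⟨ξ, hξ, -⟩ := he.exists_min hG hL he'
    exact ⟨⟨ν, hν⟩, ξ, hξ⟩
  · exact fun p p' _ hp' μ he => he.exists_same_sizes hG hL hp'
  · obtain ⟨L, U, hLU⟩ := hB.exists_isBounded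
    exact ⟨hLU.exists_isWorkerOptimal hG hL, hLU.exists_isHospitalOptimal hG hL⟩
  · intro M hM C hC u u' hH hD
    obtain ⟨hG, hL, hB⟩ := u.2
    obtain ⟨L, U, hLU⟩ := hB.exists_isBounded
    exact (hM u).exists_doctorUtility_le hLU hG hL hC hH hD (hM u').1
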